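/- **Setting.** Let $H$ be a real or complex Hilbert space, and let $K\subset H$ be a symmetric convex body, that is, a nonempty bounded convex set with $\lambda K\subset K$ for all scalars $|\lambda|\le 1$. Let $X$ be the Banach space obtained by completing the linear span of $K$ in the Minkowski functional $\|x\|_X=\inf\{\lambda>0 : x\in\lambda K\}$; it is mapped to $H$ by the continuous extension of the inclusion, and $\|x\|_H$, $\langle x,\cdot\rangle$ for $x\in X$ refer to the image of $x$ in $H$. For $s>0$ the $(K,s)$-sparse vectors are $\Gamma_s=\{x\in X : \|x\|_X\le\sqrt{s}\,\|x\|_H\}$, and $K_s=\{x\in\Gamma_s : \|x\|_H=1\}$. For a bounded operator $T:X\to Y$ and $l\ge 1$ let $e_l(T)$ be the infimum of the $\varepsilon>0$ such that the image under $T$ of the closed unit ball of $X$ is covered by at most $2^{l-1}$ translates of $\varepsilon B_Y$, where $B_Y$ is the closed unit ball of $Y$, and let $\mathcal{E}_{2,1}(T)=\sum_{l\ge 1} e_l(T)/\sqrt{l}$. Let $e(p)=1$ for $1\le p<2$ and $e(2)=3$. Let $\alpha_d$ be a $1$-homogeneous function from the bounded operators $B(X,\ell_2^d)$ to $[0,\infty)$.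 For a number $m\ge 1$ of measurements, $K$ is of entropy type $(p,\alpha_d)$ if there is a constant $M\ge 0$ with $$\mathcal{E}_{2,1}(v)\le M\, m^{1/2-1/p}(1+\ln m)^{e(p)/2}\sup_{1\le j\le m}\alpha_d(v_j)$$ for every composite map $v=(v_j)_{1\le j\le m}:X\to\ell_\infty^m(\ell_2^d)$ of bounded operators $v_j:X\to\ell_2^d$; $M_{p,\alpha_d}(K)$ denotes the smallest such constant (for this $m$). A random operator $u$ from $X$ to $\ell_2^d$ is a random element of $B(X,\ell_2^d)$ such that $u(x)$ is a random vector for every $x\in X$; if $X$ is not separable, $u$ is moreover required to be strongly measurable for the operator norm. Random operators $v_1,\dots,v_m$ are independent if the families $(v_j(x))_{x\in X}$, $1\le j\le m$, are independent. **Theorem.** There is a numerical constant $c>0$ with the following property. Let $H,K,X,\Gamma_s,\alpha_d$ be as above with $s>0$, let $1\le p\le 2$, $m\ge 1$, $\delta>0$ and $0<\zeta<1$, and suppose that $K$ is of entropy type $(p,\alpha_d)$. Let $v_1,\dots,v_m$ be independent random operators from $X$ to $\ell_2^d$ such that the $\alpha_d(v_j)$ are random variables and $$\mathbb{E}\,v_j^*v_j=\Phi\quad\text{for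 all }j=1,\dots,m,\qquad\text{i.e. }\ \mathbb{E}\langle v_j x,v_j y\rangle=\langle x,\Phi y\rangle\ \text{ for all }x,y\in X,$$ for a bounded operator $\Phi:H\to H$ with $\|\Phi\|\le 1$. Suppose that $$\frac{m^{1/p}}{(1+\ln m)^{e(p)/2}}\ \ge\ c\,M_{p,\alpha_d}(K)\,\sqrt{s}\,\delta^{-1}\,\sup_{k\in\mathbb{N},\,k\ge 1}\Big(\mathbb{E}\sup_{1\le j\le m}\alpha_d(v_j)^{2k}\Big)^{1/(2k)}$$ and $$m\ \ge\ c\,\delta^{-2}\,s\,\ln(\zeta^{-1})\,\sup_{k\in\mathbb{N},\,k\ge 1}\Big(\mathbb{E}\sup_{1\le j\le m}\|v_j\|^{2k}\Big)^{1/k}.$$ Then, with probability at least $1-\zeta$, the operator $A=\frac{1}{\sqrt m}(v_j)_{1\le j\le m}$ satisfies the RIP on $\Gamma_s$ with constant $\delta$: $$\sup_{x\in K_s}\Big|\,\|Ax\|_{\ell_2^m(\ell_2^d)}^2-\langle x,\Phi x\rangle\Big|\ \le\ \max(\delta,\delta^2).$$ -/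

import Mathlib

open MeasureTheory ProbabilityTheory
open scoped ENNReal NNReal

/-- A symmetric convex body of a (real or complex) Hilbert space `H`: a nonempty bounded convex set
`K ⊆ H` which is symmetric (`-K = K` over `ℝ`, `λK ⊆ K` for `|λ| ≤ 1` over `ℂ`).
It need be neither closed nor of full dimension. -/
structure SymmConvexBody (𝕜 H : Type*) [RCLike 𝕜] [NormedAddCommGroup H] [InnerProductSpace 𝕜 H]
    [NormedSpace ℝ H] [IsScalarTower ℝ 𝕜 H] where
  carrier : Set H
  nonempty : carrier.Nonempty
  convex : Convex ℝ carrier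
  balanced : Balanced 𝕜 carrier
  bounded : Bornology.IsBounded carrier

namespace SymmConvexBody

variable {𝕜 H : Type*} [RCLike 𝕜] [NormedAddCommGroup H] [InnerProductSpace 𝕜 H]
  [NormedSpace ℝ H] [IsScalarTower ℝ 𝕜 H] (K : SymmConvexBody 𝕜 H)

/-- The linear span of `K`, as a type that carries the Minkowski functional of `K` as its norm. -/
def PreSpace : Type _ := ↥(Submodule.span 𝕜 K.carrier)

noncomputable instance : AddCommGroup K.PreSpace :=
  inferInstanceAs (AddCommGroup ↥(Submodule.span 𝕜 K.carrier))

noncomputable instance : Module 𝕜 K.PreSpace :=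
  inferInstanceAs (Module 𝕜 ↥(Submodule.span 𝕜 K.carrier))

/-- The inclusion of the span of `K` into `H`, as a linear map. -/
noncomputable def preInclₗ : K.PreSpace →ₗ[𝕜] H := (Submodule.span 𝕜 K.carrier).subtype

/-- The Minkowski functional `p_K(x) = inf {r > 0 | x ∈ r K}`. -/
noncomputable instance : Norm K.PreSpace := ⟨fun x => gauge K.carrier (K.preInclₗ x)⟩

theorem preSpace_norm_def (x : K.PreSpace) : ‖x‖ = gauge K.carrier (K.preInclₗ x) := rfl

theorem zero_mem : (0 : H) ∈ K.carrier := by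
  obtain ⟨x, hx⟩ := K.nonempty
  simpa using K.balanced.smul_mem (a := (0 : 𝕜)) (by simp) hx

theorem smul_mem_of_le {x : H} {a b : ℝ} (ha : 0 ≤ a) (hab : a ≤ b) (hx : b • x ∈ K.carrier) :
    a • x ∈ K.carrier := by
  rcases eq_or_lt_of_le (ha.trans hab) with hb | hb
  · have : a = 0 := by linarith
    simpa [this] using K.zero_mem
  · have h := K.convex.smul_mem_of_zero_mem K.zero_mem hx (t := a / b)
      ⟨by positivity, (div_le_one hb).2 hab⟩
    rwa [smul_smul, div_mul_cancel₀ _ hb.ne'] at h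

/-- Every vector of the span is a multiple of a vector of `K`. -/
theorem exists_smul_mem {x : H} (hx : x ∈ Submodule.span 𝕜 K.carrier) :
    ∃ r : ℝ, 0 < r ∧ r • x ∈ K.carrier := by
  induction hx using Submodule.span_induction with
  | mem x h => exact ⟨1, one_pos, by simpa using h⟩
  | zero => exact ⟨1, one_pos, by simpa using K.zero_mem⟩
  | add x y _ _ hx hy =>
    obtain ⟨r, hr, hrx⟩ := hx
    obtain ⟨t, ht, hty⟩ := hy
    have h1 := K.smul_mem_of_le (a := min r t) (lt_min hr ht).le (min_le_left _ _) hrx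
    have h2 := K.smul_mem_of_le (a := min r t) (lt_min hr ht).le (min_le_right _ _) hty
    refine ⟨min r t / 2, half_pos (lt_min hr ht), ?_⟩
    have h := K.convex h1 h2 (a := 1 / 2) (b := 1 / 2) (by norm_num) (by norm_num) (by norm_num)
    convert h using 1
    rw [smul_smul, smul_smul, smul_add]
    congr 2 <;> ring
  | smul a x _ hx =>
    obtain ⟨r, hr, hrx⟩ := hx
    have hpos : 0 < 1 + ‖a‖ := by positivity
    refine ⟨r / (1 + ‖a‖), by positivity, ?_⟩
    have h := K.balanced.smul_mem (a := ((1 + ‖a‖)⁻¹ : ℝ) • a) (by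
      rw [norm_smul, Real.norm_of_nonneg (by positivity), inv_mul_le_iff₀ hpos]; linarith) hrx
    convert h using 1
    rw [smul_assoc, smul_comm a r x, smul_smul, div_eq_inv_mul]

theorem preSpace_absorbent :
    Absorbent ℝ ((Submodule.span 𝕜 K.carrier).subtype ⁻¹' K.carrier) := by
  intro x
  obtain ⟨r, hr, hrx⟩ := K.exists_smul_mem x.2
  rw [absorbs_iff_norm]
  refine ⟨r⁻¹, fun c hc => ?_⟩
  have hc0 : c ≠ 0 := by
    rintro rfl
    simp at hc
    linarith
  rw [Set.singleton_subset_iff, Set.mem_smul_set_iff_inv_smul_mem₀ hc0]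
  change c⁻¹ • (x : H) ∈ K.carrier
  have h1 : |c|⁻¹ • (x : H) ∈ K.carrier := by
    refine K.smul_mem_of_le (by positivity) ?_ hrx
    rw [Real.norm_eq_abs] at hc
    exact inv_le_of_inv_le₀ hr hc
  rcases abs_choice c with h | h
  · rwa [h] at h1
  · rw [h, inv_neg, neg_smul] at h1
    simpa using K.balanced.neg_mem_iff.2 h1

theorem gauge_subtype (x : ↥(Submodule.span 𝕜 K.carrier)) :
    gauge ((Submodule.span 𝕜 K.carrier).subtype ⁻¹' K.carrier) x = gauge K.carrier (x : H) := by
  rw [gauge_def', gauge_def']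
  rfl

/-- `K` is contained in a ball, so the Minkowski functional dominates the norm of `H`. -/
theorem exists_norm_le : ∃ R : ℝ, ∀ x : K.PreSpace, ‖K.preInclₗ x‖ ≤ R * ‖x‖ := by
  obtain ⟨R, hR0, hR⟩ := K.bounded.exists_pos_norm_le
  refine ⟨R, fun x => ?_⟩
  obtain ⟨r, hr, hrx⟩ := K.exists_smul_mem (x := K.preInclₗ x) x.2
  rw [mul_comm, ← div_le_iff₀ hR0, preSpace_norm_def, gauge_def']
  refine le_csInf ⟨r⁻¹, inv_pos.2 hr, by simpa using hrx⟩ ?_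
  rintro t ⟨ht, htx⟩
  have ht' : 0 < t := ht
  have := hR _ htx
  rw [norm_smul, norm_inv, Real.norm_of_nonneg ht'.le, inv_mul_le_iff₀ ht'] at this
  exact (div_le_iff₀ hR0).2 this

theorem preSpace_core : NormedSpace.Core 𝕜 K.PreSpace where
  norm_nonneg x := gauge_nonneg _
  norm_smul c x := by
    rw [preSpace_norm_def, preSpace_norm_def, map_smul]
    exact gauge_smul K.balanced c _
  norm_triangle x y := by
    have hc : Convex ℝ ((Submodule.span 𝕜 K.carrier).subtype ⁻¹' K.carrier) := by
      intro a ha b hb s t hs ht hst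
      exact K.convex ha hb hs ht hst
    have h := gauge_add_le hc K.preSpace_absorbent x y
    rw [K.gauge_subtype x, K.gauge_subtype y] at h
    exact (K.gauge_subtype (x + y)).symm.trans_le h
  norm_eq_zero_iff x := by
    constructor
    · intro h
      obtain ⟨R, hR⟩ := K.exists_norm_le
      have h2 := hR x
      rw [h, mul_zero] at h2
      exact Subtype.ext (norm_le_zero_iff.1 h2)
    · rintro rfl
      rw [preSpace_norm_def, map_zero, gauge_zero]

noncomputable instance : NormedAddCommGroup K.PreSpace := NormedAddCommGroup.ofCore K.preSpace_core

noncomputable instance : NormedSpace 𝕜 K.PreSpace := NormedSpace.ofCore K.preSpace_core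

/-- The inclusion of the span of `K` into `H`; it is bounded because `K` is. -/
noncomputable def preIncl : K.PreSpace →L[𝕜] H :=
  K.preInclₗ.mkContinuousOfExistsBound K.exists_norm_le

/-- The Banach space `X`: the completion of the linear span of `K` in the Minkowski functional. -/
abbrev Space : Type _ := UniformSpace.Completion K.PreSpace

/-- The canonical map `X → H`, the continuous extension of the inclusion of the span of `K`.
The `H`-norm of `x ∈ X` is `‖K.incl x‖`. -/
noncomputable def incl [CompleteSpace H] : K.Space →L[𝕜] H :=
  K.preIncl.extend (UniformSpace.Completion.toComplL (𝕜 := 𝕜) (E := K.PreSpace))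

/-- The `(K,s)`-sparse vectors `Γ_s = {x ∈ X | ‖x‖_X ≤ √s ‖x‖_H}`. -/
def sparse [CompleteSpace H] (s : ℝ) : Set K.Space := {x | ‖x‖ ≤ √s * ‖K.incl x‖}

/-- The `(K,s)`-sparse vectors of unit norm in `H`. -/
def unitSparse [CompleteSpace H] (s : ℝ) : Set K.Space := {x | x ∈ K.sparse s ∧ ‖K.incl x‖ = 1}

end SymmConvexBody

/-- The dyadic entropy number
`e_l(T, D) = inf {ε > 0 | N(T(D), ε B_Y) ≤ 2^(l-1)}`, for `l ≥ 1`. The covering number counts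
translates of `ε B_Y` with arbitrary centres. -/
noncomputable def dyadicEntropy {X Y : Type*} [PseudoEMetricSpace Y] (T : X → Y) (D : Set X)
    (l : ℕ) : ℝ≥0∞ :=
  ⨅ (ε : ℝ≥0) (_ : 0 < ε) (_ : Metric.externalCoveringNumber ε (T '' D) ≤ ((2 ^ (l - 1) : ℕ) : ℕ∞)),
    (ε : ℝ≥0∞)

/-- `𝓔_{2,1}(T) = ∑_{l ≥ 1} e_l(T, B_X) / √l`, for a bounded operator `T : X → Y`. -/
noncomputable def entropySum {𝕜 X Y : Type*} [RCLike 𝕜] [NormedAddCommGroup X] [NormedSpace 𝕜 X]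
    [NormedAddCommGroup Y] [NormedSpace 𝕜 Y] (T : X →L[𝕜] Y) : ℝ≥0∞ :=
  ∑' l : ℕ, dyadicEntropy T (Metric.closedBall (0 : X) 1) (l + 1) / ENNReal.ofReal √(l + 1)

/-- The exponent `e(p)`: `1` for `1 ≤ p < 2` and `3` for `p = 2`. -/
noncomputable def logExponent (p : ℝ) : ℝ := if p < 2 then 1 else 3

section Operators

variable {𝕜 X : Type*} [RCLike 𝕜] [NormedAddCommGroup X] [NormedSpace 𝕜 X] {d m : ℕ}

/-- Functions `α : B(X, ℓ₂^d) → [0, ∞)` that are homogeneous of degree one. -/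
def IsOneHomogeneous (α : (X →L[𝕜] EuclideanSpace 𝕜 (Fin d)) → ℝ≥0) : Prop :=
  ∀ (t : ℝ≥0) (u : X →L[𝕜] EuclideanSpace 𝕜 (Fin d)), α (((t : ℝ) : 𝕜) • u) = t * α u

/-- The bound that defines entropy type `(p, α)`, with constant `M`, for `m` measurements:
every composite map `v = (v_1, …, v_m) : X → ℓ_∞^m(ℓ₂^d)` satisfies
`𝓔_{2,1}(v) ≤ M m^(1/2 - 1/p) (1 + ln m)^(e(p)/2) sup_j α(v_j)`.
The number `m` of measurements is fixed, so `M` may depend on it; a bound that holds with one `M`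
for all `m` is a special case.
The function space `Fin m → _` carries the norm of `ℓ_∞^m`. -/
def EntropyBound (p : ℝ) (m : ℕ) (α : (X →L[𝕜] EuclideanSpace 𝕜 (Fin d)) → ℝ≥0) (M : ℝ≥0) : Prop :=
  ∀ v : Fin m → X →L[𝕜] EuclideanSpace 𝕜 (Fin d),
    entropySum (ContinuousLinearMap.pi v) ≤
      ENNReal.ofReal (M * (m : ℝ) ^ (1 / 2 - 1 / p) * (1 + Real.log m) ^ (logExponent p / 2)) *
        ⨆ j, (α (v j) : ℝ≥0∞)

/-- The unit ball of `X` is of entropy type `(p, α)` (for `m` measurements). -/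
def IsEntropyType (p : ℝ) (m : ℕ) (α : (X →L[𝕜] EuclideanSpace 𝕜 (Fin d)) → ℝ≥0) : Prop :=
  ∃ M : ℝ≥0, EntropyBound p m α M

/-- The smallest constant `M_{p,α}` in the entropy type bound. -/
noncomputable def entropyConst (p : ℝ) (m : ℕ)
    (α : (X →L[𝕜] EuclideanSpace 𝕜 (Fin d)) → ℝ≥0) : ℝ≥0 :=
  sInf {M : ℝ≥0 | EntropyBound p m α M}

/-- The measurement operator `A = m^(-1/2) (v_1, …, v_m)`, with values in `ℓ₂^m(ℓ₂^d)`. -/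
noncomputable def measurementOp (v : Fin m → X →L[𝕜] EuclideanSpace 𝕜 (Fin d)) (x : X) :
    PiLp 2 (fun _ : Fin m => EuclideanSpace 𝕜 (Fin d)) :=
  (((√(m : ℝ))⁻¹ : ℝ) : 𝕜) • WithLp.toLp 2 (fun j => v j x)

variable {Ω : Type*} [MeasurableSpace Ω]

/-- Random bounded operators `X → ℓ₂^d`: all evaluations `v(x)` are random vectors. If `X` is
nonseparable, then `v` is moreover strongly (Bochner) measurable for the operator norm. -/
def IsRandomOperator (μ : Measure Ω) (v : Ω → X →L[𝕜] EuclideanSpace 𝕜 (Fin d)) : Prop :=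
  (∀ x, Measurable fun ω => v ω x) ∧
    (TopologicalSpace.SeparableSpace X ∨ AEStronglyMeasurable v μ)

/-- Independence of random operators: the families `(v_j(x))_{x ∈ X}`, `j = 1, …, m`, are
independent (with respect to the product σ-algebra on functions on `X`). -/
def IndepOperators (μ : Measure Ω) (v : Fin m → Ω → X →L[𝕜] EuclideanSpace 𝕜 (Fin d)) : Prop :=
  iIndepFun (fun (j : Fin m) (ω : Ω) (x : X) => v j ω x) μ

/-- `𝔼 v^* v = Φ`, as an identity of sesquilinear forms on `X`:
`𝔼 ⟨v x, v y⟩ = ⟨x, Φ y⟩_H` for all `x, y ∈ X`, where `X` is mapped to `H` by `J`. -/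
def HasSecondMoment {H : Type*} [NormedAddCommGroup H] [InnerProductSpace 𝕜 H] (μ : Measure Ω)
    (J : X →L[𝕜] H) (v : Ω → X →L[𝕜] EuclideanSpace 𝕜 (Fin d)) (Φ : H →L[𝕜] H) : Prop :=
  ∀ x y : X, Integrable (fun ω => inner 𝕜 (v ω x) (v ω y)) μ ∧
    ∫ ω, inner 𝕜 (v ω x) (v ω y) ∂μ = inner 𝕜 (J x) (Φ (J y))

end Operators

/-- The restricted isometry property on the `(K,s)`-sparse vectors with constant `δ`:
`| ‖Ax‖² - ⟨x, Φ x⟩ | ≤ max(δ, δ²)` for all `(K,s)`-sparse `x` of unit norm in `H`. -/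
def SatisfiesRIP {𝕜 H F : Type*} [RCLike 𝕜] [NormedAddCommGroup H] [InnerProductSpace 𝕜 H]
    [NormedSpace ℝ H] [IsScalarTower ℝ 𝕜 H] [CompleteSpace H] [NormedAddCommGroup F]
    (K : SymmConvexBody 𝕜 H) (s δ : ℝ) (Φ : H →L[𝕜] H) (A : K.Space → F) : Prop :=
  ∀ x ∈ K.unitSparse s,
    ‖((‖A x‖ ^ 2 : ℝ) : 𝕜) - inner 𝕜 (K.incl x) (Φ (K.incl x))‖ ≤ max δ (δ ^ 2)

/-! Write the deviation of `‖Ax‖²` from its mean as the average over `j` of the independent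
variables `‖v_j x‖² - φ x`, with `φ x = ⟨x, Φ x⟩`, and estimate a high moment of its supremum over
the normalized sparse vectors. Symmetrization (`lintegral_sum_sub_integral_pow_le`) introduces
random signs. With the operators frozen, Khinchine's inequality makes the sign process subgaussian
for the metric `√S · max_j ‖v_j x - v_j y‖`, where `S` bounds the sums `∑ j, ‖v_j x‖²`. Hence `√S`
factors out, and the remaining metric is that of `ℓ_∞^m(ℓ₂^d)`, which is what the entropy numbers of
the composite map see. Dudley's chaining (`eLpNorm_signProcess_sup_le`) bounds the moment of order
`2 * 2 ^ n₀` by `√S` times a pointwise term plus the entropy sum.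

Since `φ ≤ 1`, one may take `S = m (1 + Z)`, where `Z` is the deviation itself. The estimate is thus
self-bounding: `mul_sqrt_one_add_pow_le` trades `√(1 + Z)` for half of the moment of `Z`, which
moves to the left side, and produces `max δ δ²`. Markov's inequality at a moment order of about `log
(1/ζ)` then gives the probability (`measure_max_lt_norm_average_sub_le`).

Two reductions complete the argument. A bound on all moments is an almost sure bound
(`ae_le_of_forall_lintegral_pow_le`), so the two hypotheses on `m` bound, almost surely, the entropy
sum and the values at each sparse point. Moreover, violating the estimate is an open condition on
the values, so it can be tested on a countable set even if `X` is not separable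
(`exists_countable_forall_isOpen`). Monotone limits then reduce everything to finite sets of points,
where the supremum is a norm on a finite-dimensional space. -/

/-! ### Random signs and Khinchine's inequality -/

/-- The sign `±1` encoded by a Boolean. -/
def boolSign (b : Bool) : ℝ := if b then 1 else -1

/-- The uniform probability measure on sign vectors of length `m`. -/
noncomputable def signMeasure (m : ℕ) : Measure (Fin m → Bool) :=
  ((2 : ℝ≥0∞) ^ m)⁻¹ • Measure.count

theorem lintegral_signMeasure {m : ℕ} (F : (Fin m → Bool) → ℝ≥0∞) :
    ∫⁻ ε, F ε ∂signMeasure m = ((2 : ℝ≥0∞) ^ m)⁻¹ * ∑ ε, F ε := by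
  rw [signMeasure, lintegral_smul_measure, lintegral_count, tsum_fintype, smul_eq_mul]

instance (m : ℕ) : IsProbabilityMeasure (signMeasure m) := by
  constructor
  have h := lintegral_signMeasure (m := m) (fun _ => 1)
  rw [lintegral_one] at h
  rw [h]
  simp only [Finset.sum_const, Finset.card_univ, Fintype.card_fun, Fintype.card_bool,
    Fintype.card_fin, nsmul_eq_mul, mul_one]
  push_cast
  exact ENNReal.inv_mul_cancel (by simp) (by finiteness)

theorem sum_exp_sum_boolSign {m : ℕ} (a : Fin m → ℝ) :
    ∑ ε : Fin m → Bool, Real.exp (∑ j, boolSign (ε j) * a j) = 2 ^ m * ∏ j, Real.cosh (a j) := by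
  have h := Finset.prod_univ_sum (fun _ : Fin m => (Finset.univ : Finset Bool))
    (fun j b => Real.exp (boolSign b * a j))
  rw [Fintype.piFinset_univ] at h
  simp_rw [Real.exp_sum]
  rw [← h]
  have : ∀ j, ∑ b : Bool, Real.exp (boolSign b * a j) = 2 * Real.cosh (a j) := fun j => by
    rw [Fintype.sum_bool, Real.cosh_eq]; simp [boolSign]; ring
  rw [Finset.prod_congr rfl fun j _ => this j, Finset.prod_mul_distrib]
  simp

theorem sum_exp_sum_boolSign_le {m : ℕ} (a : Fin m → ℝ) :
    ∑ ε : Fin m → Bool, Real.exp (∑ j, boolSign (ε j) * a j) ≤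
      2 ^ m * Real.exp ((∑ j, a j ^ 2) / 2) := by
  rw [sum_exp_sum_boolSign, Finset.sum_div, Real.exp_sum]
  gcongr with j
  exact Real.cosh_le_exp_half_sq _

/-- Khinchine's inequality for even moments. -/
theorem sum_sum_boolSign_pow_le {m : ℕ} (a : Fin m → ℝ) {q : ℕ} (hq : 1 ≤ q) :
    ∑ ε : Fin m → Bool, (∑ j, boolSign (ε j) * a j) ^ (2 * q) ≤
      2 ^ m * (4 * √q * √(∑ j, a j ^ 2)) ^ (2 * q) := by
  set σ := √(∑ j, a j ^ 2) with hσ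
  have hσ2 : σ ^ 2 = ∑ j, a j ^ 2 := Real.sq_sqrt (Finset.sum_nonneg fun j _ => sq_nonneg _)
  rcases eq_or_lt_of_le (Real.sqrt_nonneg (∑ j, a j ^ 2)) with h0 | h0
  · have ha : ∀ j, a j = 0 := fun j => by
      have h1 : ∑ j, a j ^ 2 = 0 := by rw [← hσ2, hσ, ← h0]; simp
      have := (Finset.sum_eq_zero_iff_of_nonneg (fun j _ => sq_nonneg (a j))).1 h1 j (by simp)
      simpa using this
    have : (2 * q) ≠ 0 := by omega
    simp [ha, this]
    positivity
  rw [← hσ] at h0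
  have hq0 : (0 : ℝ) < q := by exact_mod_cast hq
  -- This value minimizes `exp (l² σ² / 2) / l ^ (2 * q)`, the bound obtained from the exponential
  -- moment at `±l`.
  set l := √(2 * q) / σ with hl
  have hl0 : 0 < l := by positivity
  have hl2 : l ^ 2 * σ ^ 2 = 2 * q := by
    rw [hl, div_pow, Real.sq_sqrt (by positivity)]; field_simp
  have key : ∀ x : ℝ, x ^ (2 * q) ≤
      (2 * q).factorial / l ^ (2 * q) * (Real.exp (l * x) + Real.exp (-(l * x))) := fun x => by
    have h1 := Real.pow_div_factorial_le_exp |l * x| (abs_nonneg _) (2 * q)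
    have h2 : Real.exp |l * x| ≤ Real.exp (l * x) + Real.exp (-(l * x)) := by
      rcases abs_choice (l * x) with h | h <;> rw [h] <;>
        linarith [Real.exp_pos (l * x), Real.exp_pos (-(l * x))]
    have h3 := h1.trans h2
    rw [Even.pow_abs ⟨q, by ring⟩, mul_pow, div_le_iff₀ (by positivity)] at h3
    rw [div_mul_eq_mul_div, le_div_iff₀ (by positivity)]
    linarith
  have hexp : ∀ t : ℝ, t ^ 2 = l ^ 2 →
      ∑ ε : Fin m → Bool, Real.exp (t * ∑ j, boolSign (ε j) * a j) ≤ 2 ^ m * Real.exp q := by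
    intro t ht
    have := sum_exp_sum_boolSign_le (fun j => t * a j)
    simp_rw [mul_pow, ← Finset.mul_sum, ← hσ2, ht, hl2, mul_left_comm _ t, ← Finset.mul_sum] at this
    simpa using this
  calc ∑ ε : Fin m → Bool, (∑ j, boolSign (ε j) * a j) ^ (2 * q)
      ≤ ∑ ε : Fin m → Bool, (2 * q).factorial / l ^ (2 * q) *
        (Real.exp (l * ∑ j, boolSign (ε j) * a j) + Real.exp (-l * ∑ j, boolSign (ε j) * a j)) := by
        refine Finset.sum_le_sum fun ε _ => ?_
        simpa using key (∑ j, boolSign (ε j) * a j)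
    _ ≤ (2 * q).factorial / l ^ (2 * q) * (2 * (2 ^ m * Real.exp q)) := by
        rw [← Finset.mul_sum, Finset.sum_add_distrib]
        gcongr
        linarith [hexp l rfl, hexp (-l) (by ring)]
    -- Every factor is made a `q`-th power. The result is `(12 q σ²) ^ q`, and `12 ≤ 4²` gives the
    -- constant `4`.
    _ ≤ (2 * q : ℝ) ^ (2 * q) / l ^ (2 * q) * (2 ^ q * (2 ^ m * 3 ^ q)) := by
        have h1 : ((2 * q).factorial : ℝ) ≤ (2 * q : ℝ) ^ (2 * q) := by
          exact_mod_cast Nat.factorial_le_pow (2 * q)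
        have h2 : Real.exp q ≤ 3 ^ q := by
          rw [← Real.exp_one_pow]
          gcongr
          linarith [Real.exp_one_lt_d9]
        have h3 : (2 : ℝ) ≤ 2 ^ q := le_self_pow₀ (by norm_num) (by omega)
        gcongr
    _ = 2 ^ m * (12 * q * σ ^ 2) ^ q := by
        rw [pow_mul l, pow_mul (2 * (q : ℝ)), ← div_pow]
        have : (2 * (q : ℝ)) ^ 2 / l ^ 2 = 2 * q * σ ^ 2 := by
          rw [div_eq_iff (by positivity)]
          linear_combination (- 2 * q) * hl2
        rw [this, show (12 : ℝ) * q * σ ^ 2 = 2 * q * σ ^ 2 * 2 * 3 by ring,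
          mul_pow (2 * q * σ ^ 2 * 2), mul_pow (2 * q * σ ^ 2)]
        ring
    _ ≤ 2 ^ m * (4 * √q * σ) ^ (2 * q) := by
        rw [pow_mul (4 * √(q : ℝ) * σ), mul_pow (4 * √(q : ℝ)), mul_pow 4, Real.sq_sqrt hq0.le]
        gcongr
        norm_num

/-- Khinchine's inequality, in terms of `L^{2q}` norms. -/
theorem eLpNorm_sum_boolSign_le {m : ℕ} (a : Fin m → ℝ) {q : ℕ} (hq : 1 ≤ q) :
    eLpNorm (fun ε : Fin m → Bool => ∑ j, boolSign (ε j) * a j) (2 * q : ℕ) (signMeasure m) ≤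
      ENNReal.ofReal (4 * √q * √(∑ j, a j ^ 2)) := by
  have hq0 : (2 * q) ≠ 0 := by omega
  rw [eLpNorm_eq_lintegral_rpow_enorm_toReal (by exact_mod_cast hq0) (by finiteness),
    ENNReal.toReal_natCast, one_div, ENNReal.rpow_inv_le_iff (by positivity),
    lintegral_signMeasure]
  simp_rw [ENNReal.rpow_natCast]
  rw [ENNReal.inv_mul_le_iff (by simp) (by finiteness)]
  have h := ENNReal.ofReal_le_ofReal (sum_sum_boolSign_pow_le a hq)
  rw [ENNReal.ofReal_sum_of_nonneg (fun ε _ => Even.pow_nonneg ⟨q, by ring⟩ _),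
    ENNReal.ofReal_mul (by positivity), ENNReal.ofReal_pow (by positivity),
    ENNReal.ofReal_pow (by positivity), ENNReal.ofReal_ofNat] at h
  refine le_trans (Finset.sum_le_sum fun ε _ => ?_) h
  rw [← enorm_pow, Real.enorm_of_nonneg (Even.pow_nonneg ⟨q, by ring⟩ _)]

/-! ### Maxima over few functions in `L^q` -/

/-- The maximum of at most `2 ^ q` functions: the `L^q` norm increases by at most the factor `2`. -/
theorem eLpNorm_comp_fintype_le {Λ ι κ : Type*} [MeasurableSpace Λ] {P : Measure Λ} [Fintype ι]
    [Fintype κ] (h : κ → Λ → ℝ) (hm : ∀ i, AEStronglyMeasurable (h i) P) (τ : ι → κ) {q : ℕ}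
    (hq : 1 ≤ q)
    (hcard : Fintype.card κ ≤ 2 ^ q) {B : ℝ≥0∞} (hB : ∀ i, eLpNorm (h i) q P ≤ B) :
    eLpNorm (fun ω => (fun x => h (τ x) ω : ι → ℝ)) q P ≤ 2 * B := by
  have hq0 : (0 : ℝ) < q := by exact_mod_cast hq
  have hq0' : (q : ℝ≥0∞) ≠ 0 := by simp; omega
  have hB' : ∀ i, ∫⁻ ω, ‖h i ω‖ₑ ^ q ∂P ≤ B ^ q := fun i => by
    have := hB i
    rw [eLpNorm_eq_lintegral_rpow_enorm_toReal hq0' (by finiteness),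
      ENNReal.toReal_natCast, one_div, ENNReal.rpow_inv_le_iff (by positivity)] at this
    simpa using this
  rw [eLpNorm_eq_lintegral_rpow_enorm_toReal hq0' (by finiteness),
      ENNReal.toReal_natCast, one_div, ENNReal.rpow_inv_le_iff (by positivity)]
  simp_rw [ENNReal.rpow_natCast]
  calc ∫⁻ ω, ‖(fun x => h (τ x) ω : ι → ℝ)‖ₑ ^ q ∂P ≤ ∫⁻ ω, ∑ i, ‖h i ω‖ₑ ^ q ∂P := by
        refine lintegral_mono fun ω => ?_
        rcases isEmpty_or_nonempty ι with hι | hι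
        · have : (fun x => h (τ x) ω : ι → ℝ) = 0 := Subsingleton.elim _ _
          rw [this]
          simp [show q ≠ 0 by omega]
        · obtain ⟨x, hx⟩ := (Finite.exists_max fun x : ι => ‖h (τ x) ω‖)
          have : ‖(fun x => h (τ x) ω : ι → ℝ)‖ₑ ≤ ‖h (τ x) ω‖ₑ := by
            rw [enorm_le_iff_norm_le]
            exact (pi_norm_le_iff_of_nonneg (norm_nonneg _)).2 hx
          calc _ ≤ ‖h (τ x) ω‖ₑ ^ q := by gcongr
            _ ≤ _ := Finset.single_le_sum (f := fun i => ‖h i ω‖ₑ ^ q) (fun _ _ => zero_le)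
              (Finset.mem_univ _)
    _ = ∑ i, ∫⁻ ω, ‖h i ω‖ₑ ^ q ∂P :=
        lintegral_finsetSum' _ fun i _ => (hm i).enorm.pow_const q
    _ ≤ ∑ i : κ, B ^ q := Finset.sum_le_sum fun i _ => hB' i
    _ ≤ 2 ^ q * B ^ q := by
        rw [Finset.sum_const, nsmul_eq_mul, Finset.card_univ]
        gcongr
        exact_mod_cast hcard
    _ = (2 * B) ^ q := (mul_pow _ _ _).symm

/-- A family of functions which depends on its index only through a map to a set of at most `2 ^ q`
elements. -/
theorem eLpNorm_pi_le_of_factors {Λ ι κ : Type*} [MeasurableSpace Λ] {P : Measure Λ} [Fintype ι]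
    [Fintype κ] (h : ι → Λ → ℝ) (hm : ∀ i, AEStronglyMeasurable (h i) P) (τ : ι → κ)
    (hτ : ∀ x y, τ x = τ y → h x = h y) {q : ℕ} (hq : 1 ≤ q)
    (hcard : Fintype.card κ ≤ 2 ^ q) {B : ℝ≥0∞} (hB : ∀ i, eLpNorm (h i) q P ≤ B) :
    eLpNorm (fun ω => (fun x => h x ω : ι → ℝ)) q P ≤ 2 * B := by
  classical
  -- One representative for each value of `τ`. Only these functions count towards the maximum.
  let g : Set.range τ → ι := fun y => y.2.choose
  have hg : ∀ y, τ (g y) = y := fun y => y.2.choose_spec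
  have := eLpNorm_comp_fintype_le (P := P) (fun y : Set.range τ => h (g y)) (fun y => hm _)
    (fun x => ⟨τ x, x, rfl⟩) hq ((Fintype.card_subtype_le _).trans hcard) (fun y => hB _)
  refine le_of_eq_of_le ?_ this
  congr 1
  ext ω x
  exact congrFun (hτ _ _ (hg ⟨τ x, x, rfl⟩).symm) ω

/-! ### Chaining for squared norms -/

section Chaining

variable {V ι : Type*} [SeminormedAddCommGroup V] {m : ℕ} (w : ι → Fin m → V)

/-- The Rademacher process `x ↦ ∑ ε_j ‖w_x(j)‖²`. -/
noncomputable def signProcess (ε : Fin m → Bool) (x : ι) : ℝ := ∑ j, boolSign (ε j) * ‖w x j‖ ^ 2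

variable {w} {b S : ℝ}

/-- Khinchine's inequality with variance `∑ ‖w x j‖⁴ ≤ b² S`: the uniform bound `b` is used for two
of the four powers only. -/
theorem eLpNorm_signProcess_le {x : ι} (hb : ∀ j, ‖w x j‖ ≤ b) (hb0 : 0 ≤ b)
    (hS : ∑ j, ‖w x j‖ ^ 2 ≤ S) {q : ℕ} (hq : 1 ≤ q) :
    eLpNorm (fun ε => signProcess w ε x) (2 * q : ℕ) (signMeasure m) ≤
      ENNReal.ofReal (4 * √q * (√S * b)) := by
  refine (eLpNorm_sum_boolSign_le (fun j => ‖w x j‖ ^ 2) hq).trans ?_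
  gcongr
  rw [Real.sqrt_le_left (by positivity), mul_pow, Real.sq_sqrt
    ((Finset.sum_nonneg fun j _ => by positivity).trans hS)]
  calc ∑ j, (‖w x j‖ ^ 2) ^ 2 ≤ ∑ j, ‖w x j‖ ^ 2 * b ^ 2 := by
        refine Finset.sum_le_sum fun j _ => ?_
        rw [sq (‖w x j‖ ^ 2)]
        gcongr
        exact hb j
    _ ≤ S * b ^ 2 := by rw [← Finset.sum_mul]; gcongr

/-- Factor the difference of squares: one factor is at most the uniform distance `r`, and the
squares of the other sum to at most `4 S`. This separates `√S` from a metric that does not depend on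
it. -/
theorem eLpNorm_signProcess_sub_le {x y : ι} {r : ℝ} (hr : ∀ j, ‖w x j - w y j‖ ≤ r) (hr0 : 0 ≤ r)
    (hx : ∑ j, ‖w x j‖ ^ 2 ≤ S) (hy : ∑ j, ‖w y j‖ ^ 2 ≤ S) {q : ℕ} (hq : 1 ≤ q) :
    eLpNorm (fun ε => signProcess w ε x - signProcess w ε y) (2 * q : ℕ) (signMeasure m) ≤
      ENNReal.ofReal (4 * √q * (√S * (2 * r))) := by
  have h := eLpNorm_sum_boolSign_le (fun j => ‖w x j‖ ^ 2 - ‖w y j‖ ^ 2) hq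
  simp_rw [mul_sub, Finset.sum_sub_distrib] at h
  refine h.trans ?_
  gcongr
  rw [Real.sqrt_le_left (by positivity), mul_pow, Real.sq_sqrt
    ((Finset.sum_nonneg fun j _ => by positivity).trans hx)]
  calc ∑ j, (‖w x j‖ ^ 2 - ‖w y j‖ ^ 2) ^ 2
      ≤ ∑ j, (2 * ‖w x j‖ ^ 2 + 2 * ‖w y j‖ ^ 2) * r ^ 2 := by
        refine Finset.sum_le_sum fun j _ => ?_
        have h1 : (‖w x j‖ - ‖w y j‖) ^ 2 ≤ r ^ 2 := by
          rw [← sq_abs]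
          gcongr
          exact (abs_norm_sub_norm_le _ _).trans (hr j)
        rw [sq_sub_sq, mul_pow]
        gcongr
        nlinarith [sq_nonneg (‖w x j‖ - ‖w y j‖)]
    _ ≤ S * (2 * r) ^ 2 := by
        rw [← Finset.sum_mul, Finset.sum_add_distrib, ← Finset.mul_sum, ← Finset.mul_sum]
        nlinarith [sq_nonneg r]

theorem aestronglyMeasurable_signMeasure {F : Type*} [TopologicalSpace F]
    [TopologicalSpace.PseudoMetrizableSpace F] (f : (Fin m → Bool) → F) :
    AEStronglyMeasurable f (signMeasure m) :=
  (StronglyMeasurable.of_discrete).aestronglyMeasurable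

theorem eLpNorm_signProcess_comp_le [Fintype ι] {κ : Type*} [Fintype κ] {π : ι → ι} {τ : ι → κ}
    (hτ : ∀ x y, τ x = τ y → π x = π y) (hb : ∀ x j, ‖w x j‖ ≤ b) (hb0 : 0 ≤ b)
    (hS : ∀ x, ∑ j, ‖w x j‖ ^ 2 ≤ S) {q : ℕ} (hq : 1 ≤ q)
    (hcard : Fintype.card κ ≤ 2 ^ (2 * q)) :
    eLpNorm (fun ε x => signProcess w ε (π x)) (2 * q : ℕ) (signMeasure m) ≤
      ENNReal.ofReal (8 * √S * (√q * b)) := by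
  refine (eLpNorm_pi_le_of_factors (fun x ε => signProcess w ε (π x))
    (fun x => aestronglyMeasurable_signMeasure _) τ (fun x y h => by simp only [hτ x y h])
    (by omega) hcard (fun x => eLpNorm_signProcess_le (hb _) hb0 (hS _) hq)).trans ?_
  rw [← ENNReal.ofReal_ofNat 2, ← ENNReal.ofReal_mul (by norm_num)]
  exact ENNReal.ofReal_le_ofReal (le_of_eq (by ring))

theorem eLpNorm_signProcess_comp_sub_le [Fintype ι] {κ : Type*} [Fintype κ] {π π' : ι → ι}
    {τ : ι → κ} (hτ : ∀ x y, τ x = τ y → π x = π y ∧ π' x = π' y) {r : ℝ}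
    (hr : ∀ x j, ‖w (π x) j - w (π' x) j‖ ≤ r) (hr0 : 0 ≤ r)
    (hS : ∀ x, ∑ j, ‖w x j‖ ^ 2 ≤ S) {q : ℕ} (hq : 1 ≤ q)
    (hcard : Fintype.card κ ≤ 2 ^ (2 * q)) {k : ℕ} (hk : k ≤ 2 * q) :
    eLpNorm (fun ε x => signProcess w ε (π x) - signProcess w ε (π' x)) k (signMeasure m) ≤
      ENNReal.ofReal (16 * √S * (√q * r)) := by
  refine (eLpNorm_le_eLpNorm_of_exponent_le (q := (2 * q : ℕ)) (by exact_mod_cast hk)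
    (aestronglyMeasurable_signMeasure _)).trans ?_
  refine (eLpNorm_pi_le_of_factors (fun x ε => signProcess w ε (π x) - signProcess w ε (π' x))
    (fun x => aestronglyMeasurable_signMeasure _) τ
    (fun x y h => by simp only [(hτ x y h).1, (hτ x y h).2])
    (by omega) hcard
    (fun x => eLpNorm_signProcess_sub_le (hr x) hr0 (hS _) (hS _) hq)).trans ?_
  rw [← ENNReal.ofReal_ofNat 2, ← ENNReal.ofReal_mul (by norm_num)]
  exact ENNReal.ofReal_le_ofReal (le_of_eq (by ring))

/-- Dudley's bound for the moments of a Rademacher process of squared norms: the index set is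
covered, at each level `n`, by `2 ^ 2 ^ n` sets of diameter at most `r n`. -/
theorem eLpNorm_signProcess_sup_le [Fintype ι] (hb : ∀ x j, ‖w x j‖ ≤ b) (hb0 : 0 ≤ b)
    (hS : ∀ x, ∑ j, ‖w x j‖ ^ 2 ≤ S) (c : ∀ n : ℕ, ι → Fin (2 ^ 2 ^ n)) {r : ℕ → ℝ}
    (hr0 : ∀ n, 0 ≤ r n) (hc : ∀ n x y, c n x = c n y → ∀ j, ‖w x j - w y j‖ ≤ r n) {W : ℝ}
    (hW : ∀ N, ∑ n ∈ Finset.range N, √(2 ^ n) * r n ≤ W) (n₀ : ℕ) :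
    eLpNorm (signProcess w) (2 * 2 ^ n₀ : ℕ) (signMeasure m) ≤
      ENNReal.ofReal (√S * (8 * √(2 ^ n₀) * b + 64 * W)) := by
  rcases isEmpty_or_nonempty ι with hι | hι
  · have : signProcess w = 0 := by ext ε x; exact hι.elim x
    rw [this]
    simp
  -- `π n x` is a chosen point in the level-`n` class of `x`.
  let π : ℕ → ι → ι := fun n x => Function.invFun (c n) (c n x)
  have hπ : ∀ n x, c n (π n x) = c n x := fun n x => Function.invFun_eq ⟨x, rfl⟩
  have hπc : ∀ n x y, c n x = c n y → π n x = π n y := fun n x y h => by simp only [π, h]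
  set a : ℕ → ℝ := fun n => √(2 ^ n) * r n with ha
  have ha0 : ∀ n, 0 ≤ a n := fun n => mul_nonneg (Real.sqrt_nonneg _) (hr0 n)
  -- At this level the budget of `2 ^ (2 * 2 ^ N)` functions exceeds the number of points, so one
  -- last link joins `π N x` to `x` itself.
  set N := n₀ + Fintype.card ι with hN
  have hk : ∀ n, n₀ ≤ n → 2 * 2 ^ n₀ ≤ 2 * 2 ^ n := fun n hn =>
    Nat.mul_le_mul_left 2 (Nat.pow_le_pow_right two_pos hn)
  have hcast : ∀ n, (((2 ^ n : ℕ) : ℝ)) = 2 ^ n := fun n => by push_cast; rfl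
  have h1 : eLpNorm (fun ε x => signProcess w ε (π n₀ x)) (2 * 2 ^ n₀ : ℕ) (signMeasure m) ≤
      ENNReal.ofReal (8 * √S * (√(2 ^ n₀) * b)) := by
    rw [← hcast]
    refine eLpNorm_signProcess_comp_le (hπc n₀) hb hb0 hS Nat.one_le_two_pow ?_
    rw [Fintype.card_fin]
    exact Nat.pow_le_pow_right two_pos (by omega)
  -- A link depends on a pair of classes, of which there are at most `2 ^ (2 ^ (n + 1) + 2 ^ n)`.
  -- The moment of order `2 * 2 ^ (n + 1)` absorbs this maximum and dominates the one sought. Both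
  -- ends are compared with `x`, hence the radius `r (n + 1) + r n`.
  have h2 : ∀ n, n₀ ≤ n → eLpNorm (fun ε x => signProcess w ε (π (n + 1) x) -
      signProcess w ε (π n x)) (2 * 2 ^ n₀ : ℕ) (signMeasure m) ≤
      ENNReal.ofReal (16 * √S * (2 * a n + a (n + 1))) := fun n hn => by
    refine (eLpNorm_signProcess_comp_sub_le (τ := fun x => (c (n + 1) x, c n x))
      (fun x y h => ⟨hπc _ x y (Prod.mk.inj h).1, hπc _ x y (Prod.mk.inj h).2⟩)
      (r := r (n + 1) + r n) (fun x j => ?_) (add_nonneg (hr0 _) (hr0 _)) hS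
      (q := 2 ^ (n + 1)) Nat.one_le_two_pow ?_ (hk (n + 1) (by omega))).trans ?_
    · rw [← sub_add_sub_cancel _ (w x j)]
      exact (norm_add_le _ _).trans (add_le_add (hc _ _ _ (hπ _ _) j) (hc _ _ _ (hπ _ _).symm j))
    · rw [Fintype.card_prod, Fintype.card_fin, Fintype.card_fin, ← pow_add]
      exact Nat.pow_le_pow_right two_pos (by rw [pow_succ]; omega)
    · apply ENNReal.ofReal_le_ofReal
      have hs : √((2 : ℝ) ^ (n + 1)) ≤ 2 * √(2 ^ n) := by
        rw [pow_succ, Real.sqrt_mul (by positivity), mul_comm]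
        gcongr
        rw [Real.sqrt_le_left (by norm_num)]
        norm_num
      have : √((2 : ℝ) ^ (n + 1)) * r n ≤ 2 * a n := by
        rw [ha, ← mul_assoc]
        exact mul_le_mul_of_nonneg_right hs (hr0 n)
      rw [hcast]
      gcongr
      simp only [ha] at *
      linarith
  have h3 : eLpNorm (fun ε x => signProcess w ε x - signProcess w ε (π N x)) (2 * 2 ^ n₀ : ℕ)
      (signMeasure m) ≤ ENNReal.ofReal (16 * √S * a N) := by
    simp only [ha]
    rw [← hcast]
    refine eLpNorm_signProcess_comp_sub_le (π := id) (τ := id)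
      (fun x y h => ⟨h, congrArg (π N) h⟩) (fun x j => hc _ _ _ (hπ _ _).symm j)
      (hr0 _) hS Nat.one_le_two_pow ?_ (hk N (by omega))
    have e1 : Fintype.card ι ≤ N := by omega
    have e2 : N < 2 ^ N := Nat.lt_two_pow_self
    have e3 : 2 * 2 ^ N < 2 ^ (2 * 2 ^ N) := Nat.lt_two_pow_self
    omega
  have hdecomp : signProcess w = (fun ε x => signProcess w ε (π n₀ x)) +
      (∑ n ∈ Finset.Ico n₀ N, fun ε x => signProcess w ε (π (n + 1) x) - signProcess w ε (π n x)) +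
      fun ε x => signProcess w ε x - signProcess w ε (π N x) := by
    ext ε x
    simp only [Pi.add_apply, Finset.sum_apply]
    rw [Finset.sum_Ico_sub (fun n => signProcess w ε (π n x)) (by omega)]
    ring
  have hq1 : (1 : ℝ≥0∞) ≤ ((2 * 2 ^ n₀ : ℕ) : ℝ≥0∞) := by
    have : 1 ≤ 2 * 2 ^ n₀ := by have := Nat.one_le_two_pow (n := n₀); omega
    exact_mod_cast this
  rw [hdecomp]
  have hmeas : ∀ F : (Fin m → Bool) → ι → ℝ, AEStronglyMeasurable F (signMeasure m) :=
    aestronglyMeasurable_signMeasure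
  refine (eLpNorm_add_le (hmeas _) (hmeas _) hq1).trans ((add_le_add ((eLpNorm_add_le (hmeas _)
    (hmeas _) hq1).trans (add_le_add h1 ((eLpNorm_sum_le (fun n _ => hmeas _) hq1).trans
      (Finset.sum_le_sum fun n hn => h2 n (Finset.mem_Ico.1 hn).1)))) h3).trans ?_)
  have hpos : ∀ n, 0 ≤ 16 * √S * (2 * a n + a (n + 1)) := fun n => by
    have := ha0 n; have := ha0 (n + 1); positivity
  have hsum0 := Finset.sum_nonneg fun n (_ : n ∈ Finset.Ico n₀ N) => hpos n
  rw [← ENNReal.ofReal_sum_of_nonneg fun n _ => hpos n,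
    ← ENNReal.ofReal_add (by positivity) hsum0, ← ENNReal.ofReal_add (by positivity)
      (by have := ha0 N; positivity)]
  apply ENNReal.ofReal_le_ofReal
  have e1 : ∑ n ∈ Finset.Ico n₀ N, (2 * a n + a (n + 1)) + a N ≤ 4 * W := by
    have f1 : ∑ n ∈ Finset.Ico n₀ N, (2 * a n + a (n + 1)) ≤
        ∑ n ∈ Finset.range N, (2 * a n + a (n + 1)) :=
      Finset.sum_le_sum_of_subset_of_nonneg
        (fun n hn => Finset.mem_range.2 (Finset.mem_Ico.1 hn).2)
        fun n _ _ => by have := ha0 n; have := ha0 (n + 1); positivity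
    have f2 := hW (N + 1)
    have f3 := f2
    rw [Finset.sum_range_succ'] at f2
    rw [Finset.sum_range_succ] at f3
    have f7 : ∑ n ∈ Finset.range N, (2 * a n + a (n + 1)) =
        2 * ∑ n ∈ Finset.range N, a n + ∑ n ∈ Finset.range N, a (n + 1) := by
      rw [Finset.sum_add_distrib, ← Finset.mul_sum]
    rw [f7] at f1
    have f4 := ha0 0
    have f5 := ha0 N
    have f6 := Finset.sum_nonneg fun n (_ : n ∈ Finset.range N) => ha0 n
    have f8 : ∑ n ∈ Finset.range N, √(2 ^ n) * r n = ∑ n ∈ Finset.range N, a n := rfl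
    linarith
  rw [← Finset.mul_sum]
  have := mul_le_mul_of_nonneg_left e1 (by positivity : 0 ≤ 16 * √S)
  linarith

end Chaining

/-! ### Symmetrization of moments -/

section Symmetrization

/-- Jensen's inequality for integer powers. -/
theorem lintegral_pow_le_lintegral_pow {α : Type*} [MeasurableSpace α] {P : Measure α}
    [IsProbabilityMeasure P] {F : α → ℝ≥0∞} (hF : AEMeasurable F P) {k : ℕ} (hk : 1 ≤ k) :
    (∫⁻ x, F x ∂P) ^ k ≤ ∫⁻ x, F x ^ k ∂P := by
  have hk0 : (0 : ℝ) < k := by exact_mod_cast hk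
  have h := eLpNorm_le_eLpNorm_of_exponent_le (μ := P) (f := F) (p := 1) (q := k)
    (by exact_mod_cast hk) hF.aestronglyMeasurable
  rw [eLpNorm_one_eq_lintegral_enorm, eLpNorm_eq_lintegral_rpow_enorm_toReal (by positivity)
    (by finiteness), ENNReal.toReal_natCast, one_div, ENNReal.le_rpow_inv_iff hk0] at h
  simpa using h

variable {E : Type*} [NormedAddCommGroup E] [NormedSpace ℝ E] [MeasurableSpace E] [BorelSpace E]
  [SecondCountableTopology E] {m : ℕ}

/-- Independent copies of independent differences may be multiplied by signs. -/
theorem lintegral_pi_prod_sub_eq_signs (ν : Fin m → Measure E) [∀ j, IsProbabilityMeasure (ν j)]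
    (ε : Fin m → Bool) {G : E → ℝ≥0∞} (hG : Measurable G) :
    ∫⁻ p, G (∑ j, (p.1 j - p.2 j)) ∂((Measure.pi ν).prod (Measure.pi ν)) =
      ∫⁻ p, G (∑ j, boolSign (ε j) • (p.1 j - p.2 j)) ∂((Measure.pi ν).prod (Measure.pi ν)) := by
  have h1 := measurePreserving_arrowProdEquivProdArrow E E (Fin m) ν ν
  -- Exchanging the two independent copies in the coordinates with sign `-1` preserves the law and
  -- flips exactly those differences.
  have h2 : MeasurePreserving (fun (a : Fin m → E × E) j => (if ε j then id else Prod.swap) (a j))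
      (Measure.pi fun j => (ν j).prod (ν j)) (Measure.pi fun j => (ν j).prod (ν j)) := by
    refine measurePreserving_pi (f := fun j => if ε j then id else Prod.swap) _ _ fun j => ?_
    split_ifs
    · exact MeasurePreserving.id _
    · exact Measure.measurePreserving_swap
  have hm1 : Measurable fun p : (Fin m → E) × (Fin m → E) => G (∑ j, (p.1 j - p.2 j)) :=
    hG.comp (by fun_prop)
  have hm2 : Measurable fun p : (Fin m → E) × (Fin m → E) =>
      G (∑ j, boolSign (ε j) • (p.1 j - p.2 j)) :=
    hG.comp (Finset.measurable_sum _ fun j _ => by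
      exact ((measurable_pi_apply j).comp measurable_fst |>.sub
        ((measurable_pi_apply j).comp measurable_snd)).const_smul _)
  rw [← h1.lintegral_comp hm1, ← h1.lintegral_comp hm2, ← h2.lintegral_comp (by
    exact hm1.comp h1.measurable)]
  refine lintegral_congr fun a => ?_
  congr 1
  refine Finset.sum_congr rfl fun j _ => ?_
  simp only [MeasurableEquiv.arrowProdEquivProdArrow, MeasurableEquiv.coe_mk,
    Equiv.arrowProdEquivProdArrow, Equiv.coe_fn_mk, boolSign]
  split_ifs <;> simp

/-- Symmetrization of moments, for a product measure. -/
theorem lintegral_pi_sum_sub_integral_pow_le [CompleteSpace E] (ν : Fin m → Measure E)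
    [∀ j, IsProbabilityMeasure (ν j)] (hν : ∀ j, Integrable id (ν j)) (ε : Fin m → Bool) {k : ℕ}
    (hk : 1 ≤ k) :
    ∫⁻ y, ‖∑ j, (y j - ∫ z, z ∂ν j)‖ₑ ^ k ∂Measure.pi ν ≤
      2 ^ k * ∫⁻ y, ‖∑ j, boolSign (ε j) • y j‖ₑ ^ k ∂Measure.pi ν := by
  have hint : ∀ j, Integrable (fun y : Fin m → E => y j) (Measure.pi ν) := fun j =>
    (measurePreserving_eval ν j).integrable_comp_of_integrable (hν j)
  have hexp : ∀ j, ∫ y, y j ∂Measure.pi ν = ∫ z, z ∂ν j := fun j => by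
    have := (measurePreserving_eval ν j).map_eq
    rw [← this]
    have hev : AEMeasurable (Function.eval j : (Fin m → E) → E) (Measure.pi ν) :=
      (measurable_pi_apply j).aemeasurable
    exact (integral_map (f := fun z : E => z) hev aestronglyMeasurable_id).symm
  have hms : Measurable fun y : Fin m → E => ‖∑ j, boolSign (ε j) • y j‖ₑ ^ k :=
    (Finset.measurable_sum _ fun j _ => (measurable_pi_apply j).const_smul _).enorm.pow_const k
  have hmd : Measurable fun p : (Fin m → E) × (Fin m → E) => ‖∑ j, (p.1 j - p.2 j)‖ₑ := by
    fun_prop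
  calc ∫⁻ y, ‖∑ j, (y j - ∫ z, z ∂ν j)‖ₑ ^ k ∂Measure.pi ν
      ≤ ∫⁻ y, ∫⁻ z, ‖∑ j, (y j - z j)‖ₑ ^ k ∂Measure.pi ν ∂Measure.pi ν := by
        refine lintegral_mono fun y => ?_
        -- The means become the average over an independent copy, which Jensen's inequality takes
        -- out of the norm and the power.
        have h1 : ∑ j, (y j - ∫ z, z ∂ν j) = ∫ z, ∑ j, (y j - z j) ∂Measure.pi ν := by
          have h2 : ∀ j ∈ Finset.univ, Integrable (fun z : Fin m → E => y j - z j)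
            (Measure.pi ν) := fun j _ => (integrable_const _).sub (hint j)
          rw [integral_finsetSum _ h2]
          refine Finset.sum_congr rfl fun j _ => ?_
          rw [integral_sub (integrable_const _) (hint j), hexp]
          simp
        rw [h1]
        exact (pow_le_pow_left' (enorm_integral_le_lintegral_enorm _) k).trans
          (lintegral_pow_le_lintegral_pow (hmd.comp measurable_prodMk_left).aemeasurable hk)
    _ = ∫⁻ p, ‖∑ j, (p.1 j - p.2 j)‖ₑ ^ k ∂((Measure.pi ν).prod (Measure.pi ν)) :=
        (lintegral_prod _ (hmd.pow_const k).aemeasurable).symm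
    _ = ∫⁻ p, ‖∑ j, boolSign (ε j) • (p.1 j - p.2 j)‖ₑ ^ k
          ∂((Measure.pi ν).prod (Measure.pi ν)) :=
        lintegral_pi_prod_sub_eq_signs ν ε (G := fun x => ‖x‖ₑ ^ k) (by fun_prop)
    _ ≤ ∫⁻ p, 2 ^ (k - 1) * (‖∑ j, boolSign (ε j) • p.1 j‖ₑ ^ k +
          ‖∑ j, boolSign (ε j) • p.2 j‖ₑ ^ k) ∂((Measure.pi ν).prod (Measure.pi ν)) := by
        refine lintegral_mono fun p => ?_
        simp_rw [smul_sub, Finset.sum_sub_distrib]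
        refine (pow_le_pow_left' (enorm_sub_le) k).trans ?_
        have := ENNReal.rpow_add_le_mul_rpow_add_rpow ‖∑ j, boolSign (ε j) • p.1 j‖ₑ
          ‖∑ j, boolSign (ε j) • p.2 j‖ₑ (p := k) (by exact_mod_cast hk)
        have e : (k : ℝ) - 1 = ((k - 1 : ℕ) : ℝ) := by push_cast [hk]; ring
        rw [e] at this
        simpa only [ENNReal.rpow_natCast] using this
    _ = 2 ^ k * ∫⁻ y, ‖∑ j, boolSign (ε j) • y j‖ₑ ^ k ∂Measure.pi ν := by
        have e1 := lintegral_prod (μ := Measure.pi ν) (ν := Measure.pi ν)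
          (fun p => ‖∑ j, boolSign (ε j) • p.1 j‖ₑ ^ k) (hms.comp measurable_fst).aemeasurable
        have e2 := lintegral_prod (μ := Measure.pi ν) (ν := Measure.pi ν)
          (fun p => ‖∑ j, boolSign (ε j) • p.2 j‖ₑ ^ k) (hms.comp measurable_snd).aemeasurable
        have m1 : Measurable fun p : (Fin m → E) × (Fin m → E) =>
          ‖∑ j, boolSign (ε j) • p.1 j‖ₑ ^ k := hms.comp measurable_fst
        rw [lintegral_const_mul' _ _ (by finiteness), lintegral_add_left m1, e1, e2]
        simp only [lintegral_const, measure_univ, mul_one]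
        obtain ⟨l, rfl⟩ := Nat.exists_eq_add_of_le' hk
        rw [Nat.add_sub_cancel, pow_succ]
        ring

/-- Symmetrization of moments, for independent random vectors. -/
theorem lintegral_sum_sub_integral_pow_le [CompleteSpace E] {Ω : Type*} [MeasurableSpace Ω]
    {μ : Measure Ω} [IsProbabilityMeasure μ] {f : Fin m → Ω → E} (hf : ∀ j, Measurable (f j))
    (hind : iIndepFun f μ) (hint : ∀ j, Integrable (f j) μ) (ε : Fin m → Bool) {k : ℕ}
    (hk : 1 ≤ k) :
    ∫⁻ ω, ‖∑ j, (f j ω - ∫ ω', f j ω' ∂μ)‖ₑ ^ k ∂μ ≤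
      2 ^ k * ∫⁻ ω, ‖∑ j, boolSign (ε j) • f j ω‖ₑ ^ k ∂μ := by
  have hmap := (iIndepFun_iff_map_fun_eq_pi_map fun j => (hf j).aemeasurable).1 hind
  have hp : ∀ j, IsProbabilityMeasure (μ.map (f j)) := fun j =>
    Measure.isProbabilityMeasure_map (hf j).aemeasurable
  have h := lintegral_pi_sum_sub_integral_pow_le (fun j => μ.map (f j))
    (fun j => (integrable_map_measure aestronglyMeasurable_id (hf j).aemeasurable).2 (hint j)) ε hk
  rw [← hmap, lintegral_map _ (measurable_pi_lambda _ hf),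
    lintegral_map _ (measurable_pi_lambda _ hf)] at h
  · have e : ∀ j, ∫ z, z ∂μ.map (f j) = ∫ ω, f j ω ∂μ := fun j =>
      integral_map (f := fun z : E => z) (hf j).aemeasurable aestronglyMeasurable_id
    simpa only [e] using h
  · exact (Finset.measurable_sum _ fun j _ =>
      (measurable_pi_apply j).const_smul _).enorm.pow_const k
  · exact (Finset.measurable_sum _ fun j _ =>
      (measurable_pi_apply j).sub_const _).enorm.pow_const k

end Symmetrization

/-! ### The self-bounding deviation inequality -/

section Deviation

/-- The elementary inequality that absorbs the factor `√(1 + Z)` in the moment bound. -/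
theorem mul_sqrt_one_add_pow_le {η δ Z : ℝ} (hη : 0 ≤ η) (hη1 : 4 * η ≤ 1) (hδ : 0 ≤ δ)
    (hZ : 0 ≤ Z) (k : ℕ) :
    (2 * (η * δ * √(1 + Z))) ^ k ≤ 3 / 2 * (4 * η * max δ (δ ^ 2)) ^ k + 1 / 2 * Z ^ k := by
  set τ := max δ (δ ^ 2) with hτ
  have hτ0 : 0 ≤ τ := hδ.trans (le_max_left _ _)
  have h1 : (4 * η * δ) ^ k ≤ (4 * η * τ) ^ k := by gcongr; exact le_max_left _ _
  -- The square left by the inequality of the means for large `Z` is the source of `δ²` in the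
  -- maximum. The condition `4 * η ≤ 1` saves one power of `4 * η`.
  have h2 : ((4 * η * δ) ^ k) ^ 2 ≤ (4 * η * τ) ^ k := by
    rw [← pow_mul, mul_comm k, pow_mul]
    refine pow_le_pow_left₀ (by positivity) ?_ k
    calc (4 * η * δ) ^ 2 = (4 * η) * (4 * η) * δ ^ 2 := by ring
      _ ≤ (4 * η) * 1 * τ := by gcongr; exact le_max_right _ _
      _ = 4 * η * τ := by ring
  have h3 : (0 : ℝ) ≤ Z ^ k := by positivity
  rcases le_total Z 1 with h | h
  · have : √(1 + Z) ≤ 2 := by rw [Real.sqrt_le_left (by norm_num)]; linarith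
    calc (2 * (η * δ * √(1 + Z))) ^ k ≤ (2 * (η * δ * 2)) ^ k := by gcongr
      _ = (4 * η * δ) ^ k := by ring
      _ ≤ _ := by nlinarith [pow_nonneg (mul_nonneg (mul_nonneg (by norm_num : (0:ℝ) ≤ 4) hη) hτ0) k]
  · have : √(1 + Z) ≤ 2 * √Z := by
      rw [Real.sqrt_le_left (by positivity), mul_pow, Real.sq_sqrt hZ]; linarith
    calc (2 * (η * δ * √(1 + Z))) ^ k ≤ (2 * (η * δ * (2 * √Z))) ^ k := by gcongr
      _ = (4 * η * δ) ^ k * √Z ^ k := by rw [← mul_pow]; ring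
      _ ≤ 1 / 2 * (((4 * η * δ) ^ k) ^ 2 + (√Z ^ k) ^ 2) := by
        linarith [two_mul_le_add_sq ((4 * η * δ) ^ k) (√Z ^ k)]
      _ = 1 / 2 * (((4 * η * δ) ^ k) ^ 2 + Z ^ k) := by
        rw [← pow_mul (√Z), mul_comm k, pow_mul (√Z), Real.sq_sqrt hZ]
      _ ≤ _ := by nlinarith [pow_nonneg (mul_nonneg (mul_nonneg (by norm_num : (0:ℝ) ≤ 4) hη) hτ0) k]

variable {Ω ι : Type*} [MeasurableSpace Ω] [Fintype ι] {μ : Measure Ω} [IsProbabilityMeasure μ]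
  {m : ℕ} {f : Fin m → Ω → ι → ℝ} {φ : ι → ℝ}

/-- Symmetrization, averaged over the signs. -/
theorem lintegral_sum_sub_pow_le_signs (hf : ∀ j, Measurable (f j)) (hind : iIndepFun f μ)
    (hint : ∀ j, Integrable (f j) μ) (hφ : ∀ j, ∫ ω, f j ω ∂μ = φ) {k : ℕ} (hk : 1 ≤ k) :
    ∫⁻ ω, ‖∑ j, (f j ω - φ)‖ₑ ^ k ∂μ ≤
      2 ^ k * ∫⁻ ω, ∫⁻ ε, ‖∑ j, boolSign (ε j) • f j ω‖ₑ ^ k ∂signMeasure m ∂μ := by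
  have hm : ∀ ε : Fin m → Bool, Measurable fun ω => ‖∑ j, boolSign (ε j) • f j ω‖ₑ ^ k :=
    fun ε => by
      have : Measurable fun ω => ∑ j, boolSign (ε j) • f j ω :=
        Finset.measurable_sum _ fun j _ => (hf j).const_smul (boolSign (ε j))
      exact this.enorm.pow_const k
  calc ∫⁻ ω, ‖∑ j, (f j ω - φ)‖ₑ ^ k ∂μ
      = ∫⁻ _ : Fin m → Bool, ∫⁻ ω, ‖∑ j, (f j ω - φ)‖ₑ ^ k ∂μ ∂signMeasure m := by simp
    _ ≤ ∫⁻ ε, 2 ^ k * ∫⁻ ω, ‖∑ j, boolSign (ε j) • f j ω‖ₑ ^ k ∂μ ∂signMeasure m := by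
        refine lintegral_mono fun ε => ?_
        have := lintegral_sum_sub_integral_pow_le hf hind hint ε hk
        simpa only [hφ] using this
    _ = _ := by
        rw [lintegral_const_mul' _ _ (by finiteness)]
        simp_rw [lintegral_signMeasure]
        rw [lintegral_const_mul _ (Finset.measurable_sum _ fun ε _ => hm ε),
          lintegral_finsetSum _ fun ε _ => hm ε]

/-- A bound for the symmetrized moments which is relative to the square root of the sums themselves
gives a deviation inequality for averages of independent nonnegative random vectors. -/
theorem measure_max_lt_norm_average_sub_le (hm : 1 ≤ m) (hf : ∀ j, Measurable (f j))
    (hind : iIndepFun f μ) (hint : ∀ j, Integrable (f j) μ) (hφ : ∀ j, ∫ ω, f j ω ∂μ = φ)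
    (hφ1 : ∀ x, φ x ≤ 1) {B : ℝ} (hB : ∀ᵐ ω ∂μ, ∀ j, ‖f j ω‖ ≤ B) {η δ : ℝ} (hη : 0 ≤ η)
    (hη1 : 4 * η ≤ 1) (hδ : 0 < δ) {k : ℕ} (hk : 1 ≤ k)
    (hsign : ∀ᵐ ω ∂μ, ∀ S : ℝ, (∀ x, ∑ j, f j ω x ≤ S) →
      ∫⁻ ε, ‖∑ j, boolSign (ε j) • f j ω‖ₑ ^ k ∂signMeasure m ≤
        ENNReal.ofReal ((√S * (η * δ * √m)) ^ k)) :
    μ {ω | max δ (δ ^ 2) * m < ‖∑ j, (f j ω - φ)‖} ≤ ENNReal.ofReal (3 * (4 * η) ^ k) := by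
  set τ := max δ (δ ^ 2) with hτ
  have hτ0 : 0 < τ := hδ.trans_le (le_max_left _ _)
  have hm0 : (0 : ℝ) < m := by exact_mod_cast hm
  set I := ∫⁻ ω, ‖∑ j, (f j ω - φ)‖ₑ ^ k ∂μ with hI
  -- Finiteness, from the crude bound `B`, is what permits subtracting `I / 2` below.
  have hfin : I ≠ ⊤ := by
    have : I ≤ ∫⁻ _, ENNReal.ofReal (m * (B + ‖φ‖)) ^ k ∂μ := by
      refine lintegral_mono_ae (hB.mono fun ω hω => ?_)
      gcongr
      rw [← ofReal_norm]
      apply ENNReal.ofReal_le_ofReal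
      calc ‖∑ j, (f j ω - φ)‖ ≤ ∑ j : Fin m, (B + ‖φ‖) :=
            norm_sum_le_of_le _ fun j _ => (norm_sub_le _ _).trans (by gcongr; exact hω j)
        _ = m * (B + ‖φ‖) := by
          rw [Finset.sum_const, Finset.card_univ, Fintype.card_fin, nsmul_eq_mul]
    refine ne_top_of_le_ne_top ?_ this
    rw [lintegral_const, measure_univ, mul_one]
    finiteness
  have hpt : ∀ᵐ ω ∂μ, 2 ^ k * ∫⁻ ε, ‖∑ j, boolSign (ε j) • f j ω‖ₑ ^ k ∂signMeasure m ≤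
      ENNReal.ofReal (3 / 2 * (4 * η * τ * m) ^ k) +
        ENNReal.ofReal (1 / 2) * ‖∑ j, (f j ω - φ)‖ₑ ^ k := by
    filter_upwards [hsign] with ω hω
    set Y := ‖∑ j, (f j ω - φ)‖ with hY
    have hY0 : 0 ≤ Y := norm_nonneg _
    -- The random bound `S` is expressed by the deviation `Y` that is being estimated.
    have hS : ∀ x, ∑ j, f j ω x ≤ m * (1 + Y / m) := fun x => by
      have h1 := (le_abs_self _).trans (norm_le_pi_norm (∑ j, (f j ω - φ)) x)
      have h2 : (∑ j, (f j ω - φ)) x = ∑ j, f j ω x - m * φ x := by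
        simp [Finset.sum_apply]
      rw [h2] at h1
      have h3 : (m : ℝ) * φ x ≤ m * 1 := by gcongr; exact hφ1 x
      have h4 : m * (1 + Y / m) = m + Y := by field_simp
      rw [h4]
      linarith
    refine (mul_le_mul_right (hω _ hS) _).trans ?_
    have h2 : (2 : ℝ≥0∞) ^ k = ENNReal.ofReal (2 ^ k) := by
      rw [ENNReal.ofReal_pow (by norm_num), ENNReal.ofReal_ofNat]
    rw [← ofReal_norm, ← hY, ← ENNReal.ofReal_pow hY0, ← ENNReal.ofReal_mul (by norm_num),
      ← ENNReal.ofReal_add (by positivity) (by positivity), h2, ← ENNReal.ofReal_mul (by positivity)]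
    apply ENNReal.ofReal_le_ofReal
    have key := mul_sqrt_one_add_pow_le hη hη1 hδ.le (by positivity : 0 ≤ Y / m) k
    have := mul_le_mul_of_nonneg_right key (by positivity : 0 ≤ (m : ℝ) ^ k)
    rw [← mul_pow, add_mul, mul_assoc (3 / 2), ← mul_pow, mul_assoc (1 / 2), ← mul_pow,
      div_mul_cancel₀ _ hm0.ne'] at this
    refine le_of_eq_of_le ?_ this
    rw [← mul_pow, Real.sqrt_mul hm0.le]
    congr 1
    have := Real.mul_self_sqrt hm0.le
    linear_combination 2 * √(1 + Y / m) * η * δ * this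
  have hle : I ≤ ENNReal.ofReal (3 / 2 * (4 * η * τ * m) ^ k) + ENNReal.ofReal (1 / 2) * I := by
    refine (lintegral_sum_sub_pow_le_signs hf hind hint hφ hk).trans ?_
    rw [← lintegral_const_mul' _ _ (by finiteness)]
    refine (lintegral_mono_ae hpt).trans ?_
    rw [lintegral_add_left measurable_const, lintegral_const_mul' _ _ (by finiteness),
      lintegral_const, measure_univ, mul_one]
  have hI2 : I ≤ ENNReal.ofReal (3 * (4 * η * τ * m) ^ k) := by
    rw [← ENNReal.ofReal_toReal hfin] at hle ⊢
    rw [← ENNReal.ofReal_mul (by norm_num), ← ENNReal.ofReal_add (by positivity) (by positivity),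
      ENNReal.ofReal_le_ofReal_iff (by positivity)] at hle
    apply ENNReal.ofReal_le_ofReal
    linarith
  have hmarkov := mul_meas_ge_le_lintegral (μ := μ) (f := fun ω => ‖∑ j, (f j ω - φ)‖ₑ ^ k)
    ((Finset.measurable_sum _ fun j _ => (hf j).sub_const _).enorm.pow_const k)
    (ENNReal.ofReal ((τ * m) ^ k))
  have hsub : {ω | τ * m < ‖∑ j, (f j ω - φ)‖} ⊆
      {ω | ENNReal.ofReal ((τ * m) ^ k) ≤ ‖∑ j, (f j ω - φ)‖ₑ ^ k} := fun ω hω => by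
    rw [Set.mem_ofPred_eq] at hω ⊢
    rw [← ofReal_norm, ← ENNReal.ofReal_pow (norm_nonneg _)]
    gcongr
  refine (measure_mono hsub).trans ?_
  have hpos : 0 < (τ * m) ^ k := by positivity
  rw [← ENNReal.mul_le_mul_iff_right (a := ENNReal.ofReal ((τ * m) ^ k))
    (by simpa using hpos) (by finiteness)]
  refine (hmarkov.trans hI2).trans ?_
  rw [← ENNReal.ofReal_mul hpos.le]
  apply ENNReal.ofReal_le_ofReal
  rw [mul_left_comm, ← mul_pow]
  exact le_of_eq (by ring)

end Deviation

/-! ### From entropy numbers to covers -/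

section Entropy

theorem dyadicEntropy_antitone {X Y : Type*} [PseudoEMetricSpace Y] (T : X → Y) (D : Set X) :
    Antitone (dyadicEntropy T D) := by
  intro k l hkl
  refine iInf_mono fun ε => iInf_mono fun _ => le_iInf fun h => iInf_le _ (h.trans ?_)
  exact_mod_cast Nat.pow_le_pow_right two_pos (by omega)

theorem exists_isCover_of_dyadicEntropy_lt {X Y : Type*} [PseudoEMetricSpace Y] {T : X → Y}
    {D : Set X} {l : ℕ} {a : ℝ≥0∞} (h : dyadicEntropy T D l < a) :
    ∃ (ε : ℝ≥0) (C : Set Y), (ε : ℝ≥0∞) < a ∧ C.encard ≤ ((2 ^ (l - 1) : ℕ) : ℕ∞) ∧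
      Metric.IsCover ε (T '' D) C := by
  simp only [dyadicEntropy, iInf_lt_iff] at h
  obtain ⟨ε, -, hc, hε⟩ := h
  -- Adding one makes the inequality strict, so that an actual cover can be extracted from the
  -- infimum; integrality removes the one again.
  have : Metric.externalCoveringNumber ε (T '' D) < ((2 ^ (l - 1) : ℕ) : ℕ∞) + 1 :=
    hc.trans_lt (by exact_mod_cast Nat.lt_succ_self _)
  simp only [Metric.externalCoveringNumber, iInf_lt_iff] at this
  obtain ⟨C, hC, hcard⟩ := this
  exact ⟨ε, C, hε, Order.le_of_lt_add_one hcard, hC⟩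

variable {𝕜 X Y : Type*} [RCLike 𝕜] [NormedAddCommGroup X] [NormedSpace 𝕜 X]
    [NormedAddCommGroup Y] [NormedSpace 𝕜 Y]

/-- The sum `∑ 2^{n/2} e_{2^n}` is controlled by `𝓔_{2,1}`. -/
theorem tsum_sqrt_two_pow_mul_dyadicEntropy_le (T : X →L[𝕜] Y) :
    ∑' n : ℕ, ENNReal.ofReal √(2 ^ n) * dyadicEntropy T (Metric.closedBall (0 : X) 1) (2 ^ n) ≤
      3 * entropySum T := by
  set e := dyadicEntropy T (Metric.closedBall (0 : X) 1) with he
  have hanti : Antitone e := dyadicEntropy_antitone _ _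
  set f : ℕ → ℝ≥0∞ := fun l => if l = 0 then 0 else e l / ENNReal.ofReal √l with hf
  have hsum : ∑' l, f l = entropySum T := by
    rw [tsum_eq_zero_add' ENNReal.summable]
    simp [hf, entropySum, he]
  have hf1 : f 1 ≤ ∑' l, f l := ENNReal.le_tsum 1
  have hmono : ∀ ⦃k n : ℕ⦄, 1 < k → k ≤ n → f n ≤ f k := fun k n hk hkn => by
    rw [hf]
    simp only [show k ≠ 0 by omega, show n ≠ 0 by omega, if_false]
    exact ENNReal.div_le_div (hanti hkn)
      (ENNReal.ofReal_le_ofReal (Real.sqrt_le_sqrt (by exact_mod_cast hkn)))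
  calc ∑' n : ℕ, ENNReal.ofReal √(2 ^ n) * e (2 ^ n) = ∑' n : ℕ, 2 ^ n * f (2 ^ n) := by
        refine tsum_congr fun n => ?_
        have h0 : (2 : ℕ) ^ n ≠ 0 := by positivity
        have hs : (0 : ℝ) < √(2 ^ n) := by positivity
        have h2 : (2 : ℝ≥0∞) ^ n = ENNReal.ofReal √(2 ^ n) * ENNReal.ofReal √(2 ^ n) := by
          rw [← ENNReal.ofReal_mul hs.le, Real.mul_self_sqrt (by positivity),
            ENNReal.ofReal_pow (by norm_num), ENNReal.ofReal_ofNat]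
        simp only [hf, h0, if_false]
        push_cast
        rw [h2, mul_assoc, ENNReal.mul_div_cancel (by simp) (by finiteness)]
    -- Cauchy condensation for the decreasing terms `e_l / √l`.
    _ ≤ f 1 + 2 * ∑' l, f l := ENNReal.tsum_condensed_le hmono
    _ ≤ ∑' l, f l + 2 * ∑' l, f l := by gcongr
    _ = 3 * entropySum T := by rw [hsum]; ring

/-- Covers of the image of the unit ball, at the dyadic levels, with summable radii. -/
theorem exists_covers_of_entropySum_lt {T : X →L[𝕜] Y} {B : ℝ} (hB : 0 < B)
    (h : entropySum T < ENNReal.ofReal B) :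
    ∃ r : ℕ → ℝ≥0, (∀ n, ∃ C : Set Y, C.encard ≤ ((2 ^ (2 ^ n - 1) : ℕ) : ℕ∞) ∧
      Metric.IsCover (r n) (T '' Metric.closedBall 0 1) C) ∧
      ∀ N, ∑ n ∈ Finset.range N, √(2 ^ n) * r n ≤ 4 * B := by
  set e := dyadicEntropy T (Metric.closedBall (0 : X) 1) with he
  have hT := tsum_sqrt_two_pow_mul_dyadicEntropy_le T
  have hfin : ∀ n, e (2 ^ n) ≠ ⊤ := fun n hn => by
    have h1 := (ENNReal.le_tsum n).trans hT
    rw [← he, hn, ENNReal.mul_top (by simp)] at h1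
    exact (ENNReal.mul_lt_top (by simp) (h.trans ENNReal.ofReal_lt_top)).ne (top_le_iff.1 h1)
  -- The entropy numbers are infima that need not be attained. The slacks `η n` have total less than
  -- `B`, so the radii cost `3 B + B`.
  obtain ⟨η, hη, hηsum⟩ := ENNReal.exists_pos_sum_of_countable
    (ε := ENNReal.ofReal B) (by simpa using hB) ℕ
  have hlt : ∀ n, e (2 ^ n) < e (2 ^ n) + η n / ENNReal.ofReal √(2 ^ n) := fun n => by
    refine ENNReal.lt_add_right (hfin n) ?_
    simpa [ENNReal.div_eq_zero_iff] using (hη n).ne'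
  choose r C hr hC hcov using fun n => exists_isCover_of_dyadicEntropy_lt (hlt n)
  refine ⟨r, fun n => ⟨C n, hC n, hcov n⟩, fun N => ?_⟩
  rw [← ENNReal.ofReal_le_ofReal_iff (by positivity), ENNReal.ofReal_sum_of_nonneg
    fun n _ => by positivity]
  calc ∑ n ∈ Finset.range N, ENNReal.ofReal (√(2 ^ n) * r n)
      ≤ ∑ n ∈ Finset.range N, (ENNReal.ofReal √(2 ^ n) * e (2 ^ n) + η n) := by
        refine Finset.sum_le_sum fun n _ => ?_
        rw [ENNReal.ofReal_mul (by positivity), ENNReal.ofReal_coe_nnreal]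
        refine (mul_le_mul_right (hr n).le _).trans ?_
        rw [mul_add, ENNReal.mul_div_cancel (by simp) (by finiteness)]
    _ ≤ ∑' n, (ENNReal.ofReal √(2 ^ n) * e (2 ^ n) + η n) := ENNReal.sum_le_tsum _
    _ = ∑' n, ENNReal.ofReal √(2 ^ n) * e (2 ^ n) + ∑' n, (η n : ℝ≥0∞) := ENNReal.tsum_add
    _ ≤ 3 * ENNReal.ofReal B + ENNReal.ofReal B := by gcongr; exact hT.trans (by gcongr)
    _ = ENNReal.ofReal (4 * B) := by
        rw [ENNReal.ofReal_mul (by norm_num), ENNReal.ofReal_ofNat]; ring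

/-- A cover by few balls gives a partition into few sets of small diameter. -/
theorem exists_classes_of_isCover {ι : Type*} {A : Set Y} {C : Set Y} {r : ℝ≥0} {N : ℕ}
    (hC : C.encard ≤ (N : ℕ∞)) (hcov : Metric.IsCover r A C) (y : ι → Y) (hy : ∀ i, y i ∈ A) :
    ∃ c : ι → Fin N, ∀ i j, c i = c j → ‖y i - y j‖ ≤ 2 * r := by
  have hCfin : C.Finite := Set.finite_of_encard_le_coe hC
  have : Fintype C := hCfin.fintype
  have hcard : Fintype.card C ≤ Fintype.card (Fin N) := by
    rw [Fintype.card_fin]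
    rw [Set.encard_eq_coe_toFinset_card, Set.toFinset_card] at hC
    exact_mod_cast hC
  obtain ⟨emb⟩ := Function.Embedding.nonempty_of_card_le hcard
  choose z hz hd using fun i => hcov (hy i)
  have hd' : ∀ i, ‖y i - z i‖ ≤ r := fun i => by
    have : edist (y i) (z i) ≤ r := hd i
    rw [edist_nndist] at this
    rw [← dist_eq_norm, ← coe_nndist]
    exact_mod_cast this
  refine ⟨fun i => emb ⟨z i, hz i⟩, fun i j hij => ?_⟩
  have hz' : z i = z j := congrArg Subtype.val (emb.injective hij)
  calc ‖y i - y j‖ = ‖(y i - z i) - (y j - z j)‖ := by rw [hz']; congr 1; abel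
    _ ≤ r + r := (norm_sub_le _ _).trans (add_le_add (hd' i) (hd' j))
    _ = 2 * r := by ring

/-- If the image of the unit ball lies in one ball of radius `r`, then it is bounded by `r`. -/
theorem norm_apply_le_of_isCover {T : X →L[𝕜] Y} {r : ℝ≥0} {C : Set Y} (hC : C.encard ≤ 1)
    (hcov : Metric.IsCover r (T '' Metric.closedBall 0 1) C) {x : X} (hx : ‖x‖ ≤ 1) :
    ‖T x‖ ≤ r := by
  -- The centre of the ball is arbitrary, so the symmetry of the unit ball is used: `T x` and `-T x`
  -- lie in the same ball, at distance at most `2 r`.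
  obtain ⟨c, hc⟩ := exists_classes_of_isCover (N := 1) (by exact_mod_cast hC) hcov
    (fun b : Bool => if b then T x else T (-x)) (fun b => by
      cases b
      · exact ⟨-x, by simpa using hx, by simp⟩
      · exact ⟨x, by simpa using hx, by simp⟩)
  have h := hc true false (Subsingleton.elim _ _)
  have h2 : T x - T (-x) = (2 : 𝕜) • T x := by rw [map_neg, two_smul]; abel
  simp only [if_true, Bool.false_eq_true, if_false] at h
  rw [h2, norm_smul, RCLike.norm_ofNat] at h
  linarith

end Entropy

/-! ### Reduction to countably many points -/

section Separability

open Topology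

variable {𝕜 X : Type*} [RCLike 𝕜] [NormedAddCommGroup X] [NormedSpace 𝕜 X] {d m : ℕ}
  {Ω : Type*} [MeasurableSpace Ω] {μ : Measure Ω}

/-- Evaluation at the points of a bounded set is almost surely continuous for one separable
topology. -/
theorem exists_separable_topology_continuous_eval
    {v : Fin m → Ω → X →L[𝕜] EuclideanSpace 𝕜 (Fin d)} (hv : ∀ j, IsRandomOperator μ (v j))
    {S : Set X} {R : ℝ} (hR : ∀ x ∈ S, ‖x‖ ≤ R) {φ : X → ℝ} (hφ : Continuous φ) :
    ∃ t : TopologicalSpace S, @TopologicalSpace.SeparableSpace S t ∧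
      Continuous[t, inferInstance] (fun x : S => φ x) ∧
      ∀ᵐ ω ∂μ, ∀ j, Continuous[t, inferInstance] (fun x : S => v j ω x) := by
  by_cases hX : TopologicalSpace.SeparableSpace X
  · have := UniformSpace.secondCountable_of_separable X
    exact ⟨inferInstance, inferInstance, by fun_prop, .of_forall fun ω j => by fun_prop⟩
  have hsm : ∀ j, AEStronglyMeasurable (v j) μ := fun j => (hv j).2.resolve_left hX
  choose D hDc hD using fun j => (hsm j).stronglyMeasurable_mk.isSeparable_range
  have hDc' : (⋃ j, D j).Countable := Set.countable_iUnion hDc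
  have := hDc'.to_subtype
  -- Strong measurability puts almost every `v j ω` in the closure of a countable set of operators.
  -- The topology induced by their evaluations and `φ` is second countable, and on the bounded set
  -- `S` operator-norm limits are uniform, so `v j ω` stays continuous for it.
  let Ψ : S → ((⋃ j, D j : Set _) → EuclideanSpace 𝕜 (Fin d)) × ℝ :=
    fun x => (fun u => u.1 x.1, φ x)
  let t : TopologicalSpace S := TopologicalSpace.induced Ψ inferInstance
  have hΨ : Continuous Ψ := continuous_induced_dom
  have hsc : SecondCountableTopology S := TopologicalSpace.secondCountableTopology_induced _ _ Ψ
  refine ⟨t, inferInstance, continuous_snd.comp hΨ, ?_⟩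
  have hae : ∀ᵐ ω ∂μ, ∀ j, v j ω = (hsm j).mk (v j) ω :=
    ae_all_iff.2 fun j => (hsm j).ae_eq_mk
  filter_upwards [hae] with ω hω j
  have hmem : v j ω ∈ closure (D j) := by
    rw [hω j]
    exact hD j ⟨ω, rfl⟩
  refine continuous_of_uniform_approx_of_continuous fun U hU => ?_
  obtain ⟨e, he, heU⟩ := Metric.mem_uniformity_dist.1 hU
  have hRpos : 0 < |R| + 1 := by positivity
  obtain ⟨u, huD, hu⟩ := Metric.mem_closure_iff.1 hmem (e / (|R| + 1)) (by positivity)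
  refine ⟨fun x => u x.1, ?_, fun x => heU ?_⟩
  · exact (continuous_apply (⟨u, Set.mem_iUnion.2 ⟨j, huD⟩⟩ : (⋃ j, D j : Set _))).comp
      (continuous_fst.comp hΨ)
  · rw [dist_eq_norm, ← sub_apply]
    rw [dist_eq_norm, lt_div_iff₀ hRpos] at hu
    refine ((ContinuousLinearMap.le_opNorm _ _).trans ?_).trans_lt hu
    gcongr
    exact (hR x x.2).trans ((le_abs_self R).trans (by linarith))

/-- Open conditions on the values of finitely many random operators at the points of a bounded set
may be tested on a countable subset. -/
theorem exists_countable_forall_isOpen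
    {v : Fin m → Ω → X →L[𝕜] EuclideanSpace 𝕜 (Fin d)} (hv : ∀ j, IsRandomOperator μ (v j))
    {S : Set X} {R : ℝ} (hR : ∀ x ∈ S, ‖x‖ ≤ R) {φ : X → ℝ} (hφ : Continuous φ) :
    ∃ Q ⊆ S, Q.Countable ∧ ∀ᵐ ω ∂μ, ∀ U : Set ((Fin m → EuclideanSpace 𝕜 (Fin d)) × ℝ),
      IsOpen U → ∀ x ∈ S, (fun j => v j ω x, φ x) ∈ U → ∃ y ∈ Q, (fun j => v j ω y, φ y) ∈ U := by
  obtain ⟨t, hsep, hφt, hvt⟩ := exists_separable_topology_continuous_eval hv hR hφ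
  obtain ⟨Q, hQc, hQd⟩ := TopologicalSpace.exists_countable_dense S
  refine ⟨Subtype.val '' Q, ?_, hQc.image _, hvt.mono fun ω hω U hU x hx hxU => ?_⟩
  · rintro _ ⟨x, -, rfl⟩
    exact x.2
  have hcont : Continuous fun x : S => ((fun j => v j ω x, φ x) :
      (Fin m → EuclideanSpace 𝕜 (Fin d)) × ℝ) := (continuous_pi hω).prodMk hφt
  obtain ⟨y, hyQ, hyU⟩ := hQd.exists_mem_open (hU.preimage hcont) ⟨⟨x, hx⟩, hxU⟩
  exact ⟨y, ⟨y, hyQ, rfl⟩, hyU⟩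

end Separability

/-! ### From moments to almost sure bounds -/

section EssentialBounds

variable {Ω : Type*} [MeasurableSpace Ω] {μ : Measure Ω}

/-- A bound for all moments is an almost sure bound. -/
theorem ae_le_of_forall_lintegral_pow_le {G : Ω → ℝ≥0∞} (hG : AEMeasurable G μ) {L : ℝ≥0∞}
    (h : ∀ k : ℕ, 1 ≤ k → ∫⁻ ω, G ω ^ k ∂μ ≤ L ^ k) : ∀ᵐ ω ∂μ, G ω ≤ L := by
  rcases eq_or_ne L ⊤ with rfl | hL
  · simp
  have hkey : ∀ a : ℝ≥0, L < a → ∀ᵐ ω ∂μ, G ω < a := fun a ha => by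
    have ha0 : (a : ℝ≥0∞) ≠ 0 := (zero_le.trans_lt ha).ne'
    -- Markov's inequality for the `k`-th power; the right side tends to zero because `L < a`.
    have hle : ∀ k : ℕ, 1 ≤ k → μ {ω | (a : ℝ≥0∞) ≤ G ω} ≤ (L / a) ^ k := fun k hk => by
      rw [div_eq_mul_inv, mul_pow, ← ENNReal.inv_pow, ← div_eq_mul_inv,
        ENNReal.le_div_iff_mul_le (by simp [ha0]) (by simp), mul_comm]
      refine le_trans ?_ ((mul_meas_ge_le_lintegral₀ (hG.pow_const k) ((a : ℝ≥0∞) ^ k)).trans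
        (h k hk))
      exact mul_le_mul_right (measure_mono fun ω (hω : (a : ℝ≥0∞) ≤ G ω) =>
        pow_le_pow_left' hω k) _
    have hlt : L / a < 1 := ENNReal.div_lt_of_lt_mul' (by simpa using ha)
    have htend := ENNReal.tendsto_pow_atTop_nhds_zero_of_lt_one hlt
    have h0 : μ {ω | (a : ℝ≥0∞) ≤ G ω} = 0 := le_antisymm (ge_of_tendsto htend
      (Filter.eventually_atTop.2 ⟨1, hle⟩)) zero_le
    rw [ae_iff]
    simpa using h0
  obtain ⟨u, -, hu, hlim⟩ := exists_seq_strictAnti_tendsto' (x := L) (y := ⊤)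
    (lt_top_iff_ne_top.2 hL)
  have : ∀ n, ∀ᵐ ω ∂μ, G ω < u n := fun n => by
    have := hkey (u n).toNNReal (by rw [ENNReal.coe_toNNReal (hu n).2.ne]; exact (hu n).1)
    rwa [ENNReal.coe_toNNReal (hu n).2.ne] at this
  filter_upwards [ae_all_iff.2 this] with ω hω
  exact ge_of_tendsto' hlim fun n => (hω n).le

end EssentialBounds

/-! ### Deviation on finite and countable sets -/

section RandomOperators

variable {𝕜 X : Type*} [RCLike 𝕜] [NormedAddCommGroup X] [NormedSpace 𝕜 X] {d m : ℕ}

/-- Moments of the Rademacher process of an operator into `ℓ_∞^m(ℓ₂^d)`, over a finite set of points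
of norm at most `√s`, in terms of the entropy sum of the operator. -/
theorem lintegral_signMeasure_pow_le (u : Fin m → X →L[𝕜] EuclideanSpace 𝕜 (Fin d)) {ι : Type*}
    [Fintype ι] (p : ι → X) {s B b S : ℝ} (hs : 0 < s) (hp : ∀ i, ‖p i‖ ≤ √s) (hB : 0 < B)
    (hu : entropySum (ContinuousLinearMap.pi u) < ENNReal.ofReal B) (hb0 : 0 ≤ b)
    (hb : ∀ i j, ‖u j (p i)‖ ≤ b) (hS : ∀ i, ∑ j, ‖u j (p i)‖ ^ 2 ≤ S) (n₀ : ℕ) :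
    ∫⁻ ε, ‖∑ j, boolSign (ε j) • fun i => ‖u j (p i)‖ ^ 2‖ₑ ^ (2 * 2 ^ n₀) ∂signMeasure m ≤
      ENNReal.ofReal ((√S * (8 * √(2 ^ n₀) * b + 512 * (√s * B))) ^ (2 * 2 ^ n₀)) := by
  obtain ⟨r, hr, hsum⟩ := exists_covers_of_entropySum_lt hB hu
  have hs' : 0 < √s := Real.sqrt_pos.2 hs
  have hcl : ∀ n, ∃ c : ι → Fin (2 ^ 2 ^ n), ∀ x y, c x = c y →
      ∀ j, ‖u j (p x) - u j (p y)‖ ≤ 2 * √s * r n := fun n => by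
    obtain ⟨C, hC, hcov⟩ := hr n
    have hC' : C.encard ≤ ((2 ^ 2 ^ n : ℕ) : ℕ∞) := hC.trans (by
      exact_mod_cast Nat.pow_le_pow_right two_pos (Nat.sub_le _ _))
    -- Scaling into the unit ball lets its covers apply. Scaling back gives diameters `2 √s r n`,
    -- whose weighted sum is at most `8 √s B`; with the chaining constant `64` this yields `512`.
    let y : ι → X := fun i => (((√s)⁻¹ : ℝ) : 𝕜) • p i
    have hy : ∀ i, ‖y i‖ ≤ 1 := fun i => by
      rw [norm_smul, RCLike.norm_ofReal, abs_of_pos (by positivity), inv_mul_le_iff₀ hs', mul_one]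
      exact hp i
    obtain ⟨c, hc⟩ := exists_classes_of_isCover hC' hcov
      (fun i => ContinuousLinearMap.pi u (y i)) (fun i => ⟨y i, by simpa using hy i, rfl⟩)
    refine ⟨c, fun i i' hii j => ?_⟩
    have h1 := (norm_le_pi_norm _ j).trans (hc i i' hii)
    have h2 : (ContinuousLinearMap.pi u (y i) - ContinuousLinearMap.pi u (y i')) j =
        (((√s)⁻¹ : ℝ) : 𝕜) • (u j (p i) - u j (p i')) := by
      simp [y, smul_sub]
    rw [h2, norm_smul, RCLike.norm_ofReal, abs_of_pos (by positivity), inv_mul_le_iff₀ hs'] at h1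
    linarith
  choose c hc using hcl
  have key := eLpNorm_signProcess_sup_le (w := fun i j => u j (p i)) hb hb0 hS c
    (r := fun n => 2 * √s * r n) (fun n => by positivity) hc (W := 8 * (√s * B)) (fun N => by
      have := mul_le_mul_of_nonneg_left (hsum N) (by positivity : 0 ≤ 2 * √s)
      rw [Finset.mul_sum] at this
      refine (Finset.sum_le_sum fun n _ => le_of_eq ?_).trans (this.trans (le_of_eq ?_)) <;> ring)
    n₀
  have hk : 2 * 2 ^ n₀ ≠ 0 := by positivity
  have hproc : ∀ ε : Fin m → Bool, signProcess (fun i j => u j (p i)) ε =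
      ∑ j, boolSign (ε j) • fun i => ‖u j (p i)‖ ^ 2 := fun ε => by
    ext i
    simp [signProcess, Finset.sum_apply]
  rw [eLpNorm_eq_lintegral_rpow_enorm_toReal (by exact_mod_cast hk) (by finiteness),
    ENNReal.toReal_natCast, one_div, ENNReal.rpow_inv_le_iff (by positivity)] at key
  simp_rw [ENNReal.rpow_natCast, hproc] at key
  refine key.trans ?_
  rw [← ENNReal.ofReal_pow (by positivity)]
  exact le_of_eq (by ring_nf)

variable {Ω : Type*} [MeasurableSpace Ω] {μ : Measure Ω} [IsProbabilityMeasure μ]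
  {v : Fin m → Ω → X →L[𝕜] EuclideanSpace 𝕜 (Fin d)} {φ : X → ℝ}

/-- The deviation inequality on a finite set of points. -/
theorem measure_exists_mem_finset_lt_le (hm : 1 ≤ m) (hv : ∀ j x, Measurable fun ω => v j ω x)
    (hind : IndepOperators μ v) (F : Finset X)
    (hint : ∀ j, ∀ x ∈ F, Integrable (fun ω => ‖v j ω x‖ ^ 2) μ)
    (hφ : ∀ j, ∀ x ∈ F, ∫ ω, ‖v j ω x‖ ^ 2 ∂μ = φ x) (hφ1 : ∀ x ∈ F, φ x ≤ 1)
    {s B b η δ : ℝ} (hs : 0 < s) (hF : ∀ x ∈ F, ‖x‖ ≤ √s) (hB : 0 < B)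
    (hent : ∀ᵐ ω ∂μ, entropySum (ContinuousLinearMap.pi fun j => v j ω) < ENNReal.ofReal B)
    (hb0 : 0 ≤ b) (hb : ∀ᵐ ω ∂μ, ∀ j, ∀ x ∈ F, ‖v j ω x‖ ≤ b) (hη1 : 4 * η ≤ 1) (hη0 : 0 ≤ η)
    (hδ : 0 < δ) {n₀ : ℕ}
    (hη : 8 * √(2 ^ n₀) * b + 512 * (√s * B) ≤ η * δ * √m) :
    μ {ω | ∃ x ∈ F, max δ (δ ^ 2) * m < |∑ j, ‖v j ω x‖ ^ 2 - m * φ x|} ≤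
      ENNReal.ofReal (3 * (4 * η) ^ (2 * 2 ^ n₀)) := by
  have hintF : ∀ j, ∀ x : F, Integrable (fun ω => ‖v j ω x‖ ^ 2) μ := fun j x => hint j x x.2
  have hk : 1 ≤ 2 * 2 ^ n₀ := by have := Nat.one_le_two_pow (n := n₀); omega
  have h := measure_max_lt_norm_average_sub_le (μ := μ) (f := fun j ω (x : F) => ‖v j ω x‖ ^ 2)
    (φ := fun x => φ x) hm
    (fun j => measurable_pi_lambda _ fun x => (hv j x).norm.pow_const 2)
    (iIndepFun.comp hind (fun _ h (x : F) => ‖h x‖ ^ 2) fun j =>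
      measurable_pi_lambda _ fun x => (measurable_pi_apply x.1).norm.pow_const 2)
    (fun j => Integrable.of_eval (hintF j))
    (fun j => by ext x; rw [eval_integral (hintF j)]; exact hφ j x x.2)
    (fun x => hφ1 x x.2) (B := b ^ 2) (hb.mono fun ω hω j => by
      refine (pi_norm_le_iff_of_nonneg (by positivity)).2 fun x => ?_
      rw [Real.norm_of_nonneg (by positivity)]
      exact pow_le_pow_left₀ (norm_nonneg _) (hω j x x.2) 2)
    hη0 hη1 hδ hk (by
      filter_upwards [hent, hb] with ω hω hbω S hS
      refine (lintegral_signMeasure_pow_le (fun j => v j ω) (fun x : F => x.1) hs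
        (fun x => hF x x.2) hB hω hb0 (fun x j => hbω j x x.2) hS n₀).trans ?_
      gcongr)
  refine (measure_mono ?_).trans h
  rintro ω ⟨x, hx, hlt⟩
  refine hlt.trans_le ?_
  have h1 := norm_le_pi_norm (∑ j, ((fun x : F => ‖v j ω x‖ ^ 2) - fun x : F => φ x)) ⟨x, hx⟩
  refine le_of_eq_of_le ?_ h1
  simp [Finset.sum_apply]

end RandomOperators

/-- A probability bound that holds for all finite subsets of a countable set holds for the set. -/
theorem measure_exists_mem_countable_lt_le {Ω X : Type*} [MeasurableSpace Ω] {μ : Measure Ω}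
    {Q : Set X} (hQ : Q.Countable) {G : Ω → X → ℝ} {τ : ℝ}
    {β : ℝ≥0∞} (h : ∀ F : Finset X, ↑F ⊆ Q → μ {ω | ∃ x ∈ F, τ < G ω x} ≤ β) :
    μ {ω | ∃ x ∈ Q, τ < G ω x} ≤ β := by
  classical
  have := hQ.to_subtype
  have hset : {ω | ∃ x ∈ Q, τ < G ω x} =
      ⋃ F : Finset Q, {ω | ∃ x ∈ F.map (Function.Embedding.subtype _), τ < G ω x} := by
    ext ω
    simp only [Set.mem_ofPred_eq, Set.mem_iUnion]
    constructor
    · rintro ⟨x, hx, hlt⟩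
      exact ⟨{⟨x, hx⟩}, x, by simp, hlt⟩
    · rintro ⟨F, x, hx, hlt⟩
      obtain ⟨y, -, rfl⟩ := Finset.mem_map.1 hx
      exact ⟨y, y.2, hlt⟩
  rw [hset, Directed.measure_iUnion]
  · refine iSup_le fun F => h _ fun x hx => ?_
    obtain ⟨y, -, rfl⟩ := Finset.mem_map.1 (Finset.mem_coe.1 hx)
    exact y.2
  · intro F F'
    refine ⟨F ∪ F', ?_, ?_⟩ <;> rintro ω ⟨x, hx, hlt⟩ <;>
      exact ⟨x, Finset.map_subset_map.2 (by simp) hx, hlt⟩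

/-! ### Choice of the moment order and the constants -/

section Core

variable {𝕜 X : Type*} [RCLike 𝕜] [NormedAddCommGroup X] [NormedSpace 𝕜 X] {d m : ℕ}

/-- The operator norm is controlled by the entropy sum. -/
theorem norm_apply_le_of_entropySum_lt {Y : Type*} [NormedAddCommGroup Y] [NormedSpace 𝕜 Y]
    {T : X →L[𝕜] Y} {B : ℝ} (hB : 0 < B) (h : entropySum T < ENNReal.ofReal B) (x : X) :
    ‖T x‖ ≤ 4 * B * ‖x‖ := by
  obtain ⟨r, hr, hsum⟩ := exists_covers_of_entropySum_lt hB h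
  -- At level `0` the cover has at most `2 ^ (2 ^ 0 - 1) = 1` ball.
  obtain ⟨C, hC, hcov⟩ := hr 0
  have hr0 : (r 0 : ℝ) ≤ 4 * B := by simpa using hsum 1
  rcases eq_or_ne x 0 with rfl | hx
  · simp
  have hx0 : 0 < ‖x‖ := norm_pos_iff.2 hx
  have h1 := norm_apply_le_of_isCover (x := ((‖x‖⁻¹ : ℝ) : 𝕜) • x) (by simpa using hC) hcov
    (by rw [norm_smul, RCLike.norm_ofReal, abs_of_pos (by positivity), inv_mul_cancel₀ hx0.ne'])
  rw [map_smul, norm_smul, RCLike.norm_ofReal, abs_of_pos (by positivity),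
    inv_mul_le_iff₀ hx0] at h1
  nlinarith

/-- One factor `3⁻ᵏ` of `9⁻ᵏ` pays for the constant `3`; the other is below `e⁻ᵏ ≤ ζ`. -/
theorem three_mul_pow_le {η ζ : ℝ} (hη0 : 0 ≤ η) (hη : η ≤ 1 / 9) (hζ : 0 < ζ) {k : ℕ} (hk : 1 ≤ k)
    (hkζ : Real.log ζ⁻¹ ≤ k) : 3 * η ^ k ≤ ζ := by
  have h1 : (1 / 3 : ℝ) ^ k ≤ 1 / 3 := pow_le_of_le_one (by norm_num) (by norm_num) (by omega)
  calc 3 * η ^ k ≤ 3 * (1 / 3 * (1 / 3)) ^ k := by gcongr; linarith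
    _ = 3 * (1 / 3) ^ k * (1 / 3) ^ k := by rw [mul_pow]; ring
    _ ≤ 3 * (1 / 3) * (1 / 3) ^ k := by gcongr
    _ = (3 ^ k)⁻¹ := by rw [one_div, inv_pow]; ring
    _ ≤ (Real.exp k)⁻¹ := by
        rw [← Real.exp_one_pow]
        gcongr
        linarith [Real.exp_one_lt_d9]
    _ ≤ (Real.exp (Real.log ζ⁻¹))⁻¹ := by gcongr
    _ = ζ := by rw [Real.exp_log (by positivity), inv_inv]

variable {Ω : Type*} [MeasurableSpace Ω] {μ : Measure Ω} [IsProbabilityMeasure μ]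
  {v : Fin m → Ω → X →L[𝕜] EuclideanSpace 𝕜 (Fin d)} {φ : X → ℝ}

/-- The deviation inequality on a bounded set, under an almost sure bound for the entropy of the
random operators and an almost sure bound for their values. -/
theorem measure_exists_lt_le_of_entropySum_le (hm : 1 ≤ m) (hv : ∀ j, IsRandomOperator μ (v j))
    (hind : IndepOperators μ v) {S : Set X} (hφc : Continuous φ)
    (hint : ∀ j, ∀ x ∈ S, Integrable (fun ω => ‖v j ω x‖ ^ 2) μ)
    (hφ : ∀ j, ∀ x ∈ S, ∫ ω, ‖v j ω x‖ ^ 2 ∂μ = φ x) (hφ1 : ∀ x ∈ S, φ x ≤ 1)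
    {s δ ζ : ℝ} (hs : 0 < s) (hS : ∀ x ∈ S, ‖x‖ ≤ √s) (hδ : 0 < δ) (hζ : 0 < ζ) (hζ1 : ζ < 1)
    (hent : ∀ᵐ ω ∂μ, entropySum (ContinuousLinearMap.pi fun j => v j ω) ≤
      ENNReal.ofReal (δ * √m / (3600 ^ 2 * √s)))
    (hval : ∀ x ∈ S, ∀ j, ∀ᵐ ω ∂μ, ‖v j ω x‖ ^ 2 ≤ m * δ ^ 2 / (3600 ^ 2 * Real.log ζ⁻¹)) :
    μ {ω | ∃ x ∈ S, max δ (δ ^ 2) * m < |∑ j, ‖v j ω x‖ ^ 2 - m * φ x|} ≤ ENNReal.ofReal ζ := by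
  have hm0 : (0 : ℝ) < m := by exact_mod_cast hm
  have hs' : 0 < √s := Real.sqrt_pos.2 hs
  have hm' : 0 < √(m : ℝ) := Real.sqrt_pos.2 hm0
  set l := Real.log ζ⁻¹ with hl
  have hl0 : 0 < l := Real.log_pos ((one_lt_inv₀ hζ).2 hζ1)
  -- The moment order `2 * 2 ^ n₀` exceeds `log ζ⁻¹`, while `2 ^ n₀ ≤ max l 1` keeps the pointwise
  -- term `√(2 ^ n₀) b` under control.
  obtain ⟨n₀, hn, hn'⟩ := exists_nat_pow_near (le_max_right l 1) one_lt_two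
  -- The factor `2` makes the entropy bound strict.
  set B := 2 * (δ * √m / (3600 ^ 2 * √s)) with hBdef
  have hB : 0 < B := by positivity
  have hsB : √s * B = 2 * (δ * √m) / 3600 ^ 2 := by rw [hBdef]; field_simp
  have hent' : ∀ᵐ ω ∂μ, entropySum (ContinuousLinearMap.pi fun j => v j ω) < ENNReal.ofReal B :=
    hent.mono fun ω hω => hω.trans_lt ((ENNReal.ofReal_lt_ofReal_iff hB).2 (by
      rw [hBdef]; linarith [show 0 < δ * √m / (3600 ^ 2 * √s) by positivity]))
  obtain ⟨b, hb0, hbn, hb⟩ : ∃ b : ℝ, 0 ≤ b ∧ √(2 ^ n₀) * b ≤ 8 * (δ * √m / 3600) ∧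
      ∀ x ∈ S, ∀ᵐ ω ∂μ, ∀ j, ‖v j ω x‖ ≤ b := by
    rcases le_total 1 l with h1 | h1
    · rw [max_eq_left h1] at hn
      refine ⟨√(m * δ ^ 2 / (3600 ^ 2 * l)), Real.sqrt_nonneg _, ?_, fun x hx => ?_⟩
      · calc √(2 ^ n₀) * √(m * δ ^ 2 / (3600 ^ 2 * l))
            ≤ √l * √(m * δ ^ 2 / (3600 ^ 2 * l)) := by gcongr
          _ = √((√m * δ / 3600) ^ 2) := by
              rw [← Real.sqrt_mul hl0.le, div_pow, mul_pow, Real.sq_sqrt hm0.le]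
              congr 1
              field_simp
          _ = δ * √m / 3600 := by rw [Real.sqrt_sq (by positivity)]; ring
          _ ≤ _ := by linarith [show 0 < δ * √m / 3600 by positivity]
      · filter_upwards [ae_all_iff.2 (hval x hx)] with ω hω j
        exact Real.le_sqrt_of_sq_le (hω j)
    -- For `ζ` near `1` the bound from `hval` degenerates as `l → 0`. Here `2 ^ n₀ ≤ 1`, and the
    -- operator norm bound implied by the entropy suffices.
    · rw [max_eq_right h1] at hn
      refine ⟨4 * B * √s, by positivity, ?_, fun x hx => hent'.mono fun ω hω j => ?_⟩
      · calc √(2 ^ n₀) * (4 * B * √s) ≤ 1 * (4 * B * √s) := by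
              gcongr
              exact Real.sqrt_le_one.2 hn
          _ = 4 * (√s * B) := by ring
          _ ≤ 8 * (δ * √m / 3600) := by
              rw [hsB]
              linarith [show 0 < δ * √m by positivity]
      · have h2 := (norm_le_pi_norm _ j).trans (norm_apply_le_of_entropySum_lt hB hω x)
        exact h2.trans (by gcongr; exact hS x hx)
  obtain ⟨Q, hQS, hQc, hQ⟩ := exists_countable_forall_isOpen hv hS hφc
  have hU : IsOpen {q : (Fin m → EuclideanSpace 𝕜 (Fin d)) × ℝ |
      max δ (δ ^ 2) * m < |∑ j, ‖q.1 j‖ ^ 2 - m * q.2|} :=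
    isOpen_lt continuous_const (by fun_prop)
  refine (measure_mono_ae (hQ.mono fun ω hω => ?_)).trans
    (measure_exists_mem_countable_lt_le (G := fun ω x => |∑ j, ‖v j ω x‖ ^ 2 - m * φ x|)
      (τ := max δ (δ ^ 2) * m) hQc fun F hFQ => ?_)
  · rintro ⟨x, hx, hlt⟩
    exact hω _ hU x hx hlt
  · have hFS : ∀ x ∈ F, x ∈ S := fun x hx => hQS (hFQ hx)
    -- The pointwise term contributes at most `64 / 3600` and the entropy term `1024 / 3600²`,
    -- together below `100 / 3600`; then `4 * η = 1 / 9`, as `three_mul_pow_le` requires.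
    refine (measure_exists_mem_finset_lt_le (n₀ := n₀) (η := 100 / 3600) hm (fun j => (hv j).1) hind
      F (fun j x hx => hint j x (hFS x hx)) (fun j x hx => hφ j x (hFS x hx))
      (fun x hx => hφ1 x (hFS x hx)) hs (fun x hx => hS x (hFS x hx)) hB hent' hb0 ?_
      (by norm_num) (by norm_num) hδ ?_).trans (ENNReal.ofReal_le_ofReal
        (three_mul_pow_le (by norm_num) (by norm_num) hζ ?_ ?_))
    · have := (Finset.countable_toSet F).to_subtype
      have := ae_all_iff.2 fun x : (F : Set X) => hb x (hFS x x.2)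
      exact this.mono fun ω hω j x hx => hω ⟨x, hx⟩ j
    · rw [hsB]
      have := show 0 < δ * √m by positivity
      linarith
    · have := Nat.one_le_two_pow (n := n₀)
      omega
    · push_cast
      rw [pow_succ] at hn'
      linarith [le_max_left l 1]

end Core

/-! ### The hypotheses of the theorem as almost sure bounds -/

section RestrictedIsometry

variable {𝕜 X : Type*} [RCLike 𝕜] [NormedAddCommGroup X] [NormedSpace 𝕜 X] {d m : ℕ}

/-- The infimum in the definition of the entropy type constant is attained. -/
theorem IsEntropyType.entropyBound_entropyConst {p : ℝ}
    {α : (X →L[𝕜] EuclideanSpace 𝕜 (Fin d)) → ℝ≥0} (h : IsEntropyType p m α) :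
    EntropyBound p m α (entropyConst p m α) := by
  intro v
  obtain ⟨u, -, hu, hmem⟩ := exists_seq_tendsto_sInf (S := {M : ℝ≥0 | EntropyBound p m α M}) h
    (OrderBot.bddBelow _)
  have hsup : ⨆ j, (α (v j) : ℝ≥0∞) ≠ ⊤ :=
    (ENNReal.iSup_coe_lt_top.2 (Set.finite_range _).bddAbove).ne
  have hlim : Filter.Tendsto (fun n => ENNReal.ofReal
      (u n * (m : ℝ) ^ (1 / 2 - 1 / p) * (1 + Real.log m) ^ (logExponent p / 2)) *
        ⨆ j, (α (v j) : ℝ≥0∞)) Filter.atTop (nhds (ENNReal.ofReal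
      (entropyConst p m α * (m : ℝ) ^ (1 / 2 - 1 / p) * (1 + Real.log m) ^ (logExponent p / 2)) *
        ⨆ j, (α (v j) : ℝ≥0∞))) :=
    ENNReal.Tendsto.mul_const (ENNReal.tendsto_ofReal
      (((NNReal.tendsto_coe.2 hu).mul_const _).mul_const _)) (Or.inr hsup)
  exact ge_of_tendsto' hlim fun n => hmem n v

variable {Ω : Type*} [MeasurableSpace Ω] {μ : Measure Ω}

/-- The supremum of the `L^{2k}` norms dominates the essential supremum. Only even moments are
available, so the moment criterion is applied to the squares `G j ^ 2`. -/
theorem ae_iSup_le_iSup_moments {G : Fin m → Ω → ℝ≥0∞} (hG : ∀ j, AEMeasurable (G j) μ) :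
    ∀ᵐ ω ∂μ, ⨆ j, G j ω ≤ ⨆ (k : ℕ) (_ : 1 ≤ k),
      (∫⁻ ω, ⨆ j, G j ω ^ (2 * k) ∂μ) ^ (1 / (2 * k : ℝ)) := by
  set L := ⨆ (k : ℕ) (_ : 1 ≤ k), (∫⁻ ω, ⨆ j, G j ω ^ (2 * k) ∂μ) ^ (1 / (2 * k : ℝ)) with hL
  have hj : ∀ j, ∀ᵐ ω ∂μ, G j ω ≤ L := fun j => by
    have := ae_le_of_forall_lintegral_pow_le (G := fun ω => G j ω ^ 2) ((hG j).pow_const 2)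
      (L := L ^ 2) (fun k hk => by
        have hk0 : (0 : ℝ) < 2 * k := by positivity
        have h1 : (∫⁻ ω, ⨆ j, G j ω ^ (2 * k) ∂μ) ^ (1 / (2 * k : ℝ)) ≤ L :=
          le_iSup₂ (f := fun (k : ℕ) (_ : 1 ≤ k) =>
            (∫⁻ ω, ⨆ j, G j ω ^ (2 * k) ∂μ) ^ (1 / (2 * k : ℝ))) k hk
        rw [one_div, ENNReal.rpow_inv_le_iff hk0,
          show (2 * k : ℝ) = ((2 * k : ℕ) : ℝ) by push_cast; rfl, ENNReal.rpow_natCast] at h1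
        simp_rw [← pow_mul]
        exact (lintegral_mono fun ω => le_iSup (fun j => G j ω ^ (2 * k)) j).trans h1)
    filter_upwards [this] with ω hω
    by_contra hlt
    exact (ENNReal.pow_lt_pow_left two_ne_zero (not_le.1 hlt)).not_ge hω
  filter_upwards [ae_all_iff.2 hj] with ω hω
  exact iSup_le hω

/-- The entropy type bound holds for each realization. Inserting the almost sure bound for `α`, the
logarithms cancel and `m^(1/2 - 1/p) m^(1/p) = √m`. -/
theorem ae_entropySum_le {p s δ c : ℝ} (hm : 1 ≤ m) (hs : 0 < s)
    (hδ : 0 < δ) (hc : 0 < c) {α : (X →L[𝕜] EuclideanSpace 𝕜 (Fin d)) → ℝ≥0}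
    {v : Fin m → Ω → X →L[𝕜] EuclideanSpace 𝕜 (Fin d)} (htype : IsEntropyType p m α)
    (hα : ∀ j, AEMeasurable (fun ω => α (v j ω)) μ)
    (h : ENNReal.ofReal (c * entropyConst p m α * √s * δ⁻¹) *
        (⨆ (k : ℕ) (_ : 1 ≤ k),
          (∫⁻ ω, ⨆ j, (α (v j ω) : ℝ≥0∞) ^ (2 * k) ∂μ) ^ (1 / (2 * k : ℝ))) ≤
      ENNReal.ofReal ((m : ℝ) ^ (1 / p) / (1 + Real.log m) ^ (logExponent p / 2))) :
    ∀ᵐ ω ∂μ, entropySum (ContinuousLinearMap.pi fun j => v j ω) ≤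
      ENNReal.ofReal (δ * √m / (c * √s)) := by
  filter_upwards [ae_iSup_le_iSup_moments fun j => (hα j).coe_nnreal_ennreal] with ω hω
  refine (htype.entropyBound_entropyConst _).trans ((mul_le_mul_right hω _).trans ?_)
  have hm0 : (0 : ℝ) < m := by exact_mod_cast hm
  have hlog : 0 ≤ Real.log m := Real.log_natCast_nonneg m
  have hs' : 0 < √s := Real.sqrt_pos.2 hs
  set M : ℝ := (entropyConst p m α : ℝ)
  set lg := (1 + Real.log m) ^ (logExponent p / 2) with hlg
  have hlg0 : 0 < lg := Real.rpow_pos_of_pos (by linarith) _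
  set a := (m : ℝ) ^ (1 / 2 - 1 / p) with ha
  have ha0 : 0 < a := Real.rpow_pos_of_pos hm0 _
  have ham : a * (m : ℝ) ^ (1 / p) = √m := by
    rw [ha, ← Real.rpow_add hm0, sub_add_cancel, Real.sqrt_eq_rpow]
  have e1 : M * a * lg = a * lg * δ / (c * √s) * (c * M * √s * δ⁻¹) := by field_simp
  have e2 : δ * √m / (c * √s) = a * lg * δ / (c * √s) * ((m : ℝ) ^ (1 / p) / lg) := by
    rw [← ham]; field_simp
  rw [e1, e2, ENNReal.ofReal_mul (by positivity), mul_assoc,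
    ENNReal.ofReal_mul (by positivity : 0 ≤ a * lg * δ / (c * √s))]
  exact mul_le_mul_right h _

/-- The moments of `‖v_j‖` dominate those of `‖v_j x‖ / √s`. Working at a fixed `x` requires only
the measurability of evaluations, not that of the operator norm. -/
theorem ae_norm_apply_sq_le {s δ l c : ℝ} (hs : 0 < s)
    (hδ : 0 < δ) (hl : 0 < l) (hc : 0 < c) {v : Fin m → Ω → X →L[𝕜] EuclideanSpace 𝕜 (Fin d)}
    (hv : ∀ j x, Measurable fun ω => v j ω x) {x : X} (hx : ‖x‖ ≤ √s)
    (h : ENNReal.ofReal (c * (δ ^ 2)⁻¹ * s * l) *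
        (⨆ (k : ℕ) (_ : 1 ≤ k), (∫⁻ ω, ⨆ j, ‖v j ω‖ₑ ^ (2 * k) ∂μ) ^ (1 / (k : ℝ))) ≤
      ENNReal.ofReal (m : ℝ)) (j : Fin m) :
    ∀ᵐ ω ∂μ, ‖v j ω x‖ ^ 2 ≤ m * δ ^ 2 / (c * l) := by
  set R := ⨆ (k : ℕ) (_ : 1 ≤ k), (∫⁻ ω, ⨆ j, ‖v j ω‖ₑ ^ (2 * k) ∂μ) ^ (1 / (k : ℝ)) with hR
  have hx2 : ‖x‖ₑ ^ 2 ≤ ENNReal.ofReal s := by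
    rw [← ofReal_norm, ← ENNReal.ofReal_pow (norm_nonneg _)]
    apply ENNReal.ofReal_le_ofReal
    exact (pow_le_pow_left₀ (norm_nonneg _) hx 2).trans_eq (Real.sq_sqrt hs.le)
  have hkey := ae_le_of_forall_lintegral_pow_le (μ := μ) (G := fun ω => ‖v j ω x‖ₑ ^ 2)
    ((hv j x).enorm.pow_const 2).aemeasurable (L := ENNReal.ofReal s * R) (fun k hk => by
      have hk0 : (0 : ℝ) < k := by exact_mod_cast hk
      have h1 : (∫⁻ ω, ⨆ j, ‖v j ω‖ₑ ^ (2 * k) ∂μ) ^ (1 / (k : ℝ)) ≤ R :=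
        le_iSup₂ (f := fun (k : ℕ) (_ : 1 ≤ k) =>
          (∫⁻ ω, ⨆ j, ‖v j ω‖ₑ ^ (2 * k) ∂μ) ^ (1 / (k : ℝ))) k hk
      rw [one_div, ENNReal.rpow_inv_le_iff hk0, ENNReal.rpow_natCast] at h1
      calc ∫⁻ ω, (‖v j ω x‖ₑ ^ 2) ^ k ∂μ
          ≤ ∫⁻ ω, ENNReal.ofReal s ^ k * ⨆ j, ‖v j ω‖ₑ ^ (2 * k) ∂μ := by
            refine lintegral_mono fun ω => ?_
            calc (‖v j ω x‖ₑ ^ 2) ^ k ≤ ((‖v j ω‖ₑ * ‖x‖ₑ) ^ 2) ^ k := by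
                  gcongr
                  exact (v j ω).le_opENorm x
              _ = (‖x‖ₑ ^ 2) ^ k * ‖v j ω‖ₑ ^ (2 * k) := by
                  rw [mul_pow, mul_pow, pow_mul, mul_comm]
              _ ≤ _ := by
                  gcongr
                  exact le_iSup (fun j => ‖v j ω‖ₑ ^ (2 * k)) j
        _ = ENNReal.ofReal s ^ k * ∫⁻ ω, ⨆ j, ‖v j ω‖ₑ ^ (2 * k) ∂μ :=
            lintegral_const_mul' _ _ (by finiteness)
        _ ≤ ENNReal.ofReal s ^ k * R ^ k := by gcongr
        _ = (ENNReal.ofReal s * R) ^ k := (mul_pow _ _ _).symm)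
  have hbound : ENNReal.ofReal s * R ≤ ENNReal.ofReal (m * δ ^ 2 / (c * l)) := by
    have e1 : s = δ ^ 2 / (c * l) * (c * (δ ^ 2)⁻¹ * s * l) := by field_simp
    have e2 : (m : ℝ) * δ ^ 2 / (c * l) = δ ^ 2 / (c * l) * m := by ring
    rw [e1, e2, ENNReal.ofReal_mul (by positivity), mul_assoc,
      ENNReal.ofReal_mul (by positivity : 0 ≤ δ ^ 2 / (c * l))]
    exact mul_le_mul_right h _
  filter_upwards [hkey] with ω hω
  have := hω.trans hbound
  rwa [← ofReal_norm, ← ENNReal.ofReal_pow (norm_nonneg _),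
    ENNReal.ofReal_le_ofReal_iff (by positivity)] at this

theorem norm_measurementOp_sq (v : Fin m → X →L[𝕜] EuclideanSpace 𝕜 (Fin d)) (x : X) :
    ‖measurementOp v x‖ ^ 2 = (∑ j, ‖v j x‖ ^ 2) / m := by
  rw [measurementOp, norm_smul, mul_pow, RCLike.norm_ofReal, sq_abs, inv_pow,
    Real.sq_sqrt (Nat.cast_nonneg m), PiLp.norm_sq_eq_of_L2, ← div_eq_inv_mul]

theorem HasSecondMoment.integrable_norm_sq {H : Type*} [NormedAddCommGroup H]
    [InnerProductSpace 𝕜 H] {J : X →L[𝕜] H} {v : Ω → X →L[𝕜] EuclideanSpace 𝕜 (Fin d)}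
    {Φ : H →L[𝕜] H} (h : HasSecondMoment μ J v Φ) (x : X) :
    Integrable (fun ω => ‖v ω x‖ ^ 2) μ := by
  have := (h x x).1.re
  simpa only [inner_self_eq_norm_sq] using this

/-- In particular `⟨x, Φ x⟩` is real on the image of `X`, without assuming `Φ` self-adjoint, so the
scalar deviation is a real absolute value. -/
theorem HasSecondMoment.inner_eq_integral {H : Type*} [NormedAddCommGroup H]
    [InnerProductSpace 𝕜 H] {J : X →L[𝕜] H} {v : Ω → X →L[𝕜] EuclideanSpace 𝕜 (Fin d)}
    {Φ : H →L[𝕜] H} (h : HasSecondMoment μ J v Φ) (x : X) :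
    inner 𝕜 (J x) (Φ (J x)) = ((∫ ω, ‖v ω x‖ ^ 2 ∂μ : ℝ) : 𝕜) := by
  rw [← (h x x).2, ← integral_ofReal]
  simp only [inner_self_eq_norm_sq_to_K, RCLike.ofReal_pow]

end RestrictedIsometry

/-! ### The theorem -/

theorem theorem2p1 :
    ∃ c : ℝ, 0 < c ∧
      ∀ (𝕜 : Type*) [RCLike 𝕜]
        (H : Type*) [NormedAddCommGroup H] [InnerProductSpace 𝕜 H] [NormedSpace ℝ H]
        [IsScalarTower ℝ 𝕜 H] [CompleteSpace H]
        (Ω : Type*) [MeasurableSpace Ω] (μ : Measure Ω) [IsProbabilityMeasure μ]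
        (K : SymmConvexBody 𝕜 H) (d m : ℕ) (p s δ ζ : ℝ)
        (α : (K.Space →L[𝕜] EuclideanSpace 𝕜 (Fin d)) → ℝ≥0)
        (Φ : H →L[𝕜] H) (v : Fin m → Ω → K.Space →L[𝕜] EuclideanSpace 𝕜 (Fin d)),
        1 ≤ m → 1 ≤ p → p ≤ 2 → 0 < s → 0 < δ → 0 < ζ → ζ < 1 →
        IsOneHomogeneous α →
        IsEntropyType p m α →
        (∀ j, IsRandomOperator μ (v j)) →
        (∀ j, AEMeasurable (fun ω => α (v j ω)) μ) →
        IndepOperators μ v →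
        (∀ j, HasSecondMoment μ K.incl (v j) Φ) →
        ‖Φ‖ ≤ 1 →
        ENNReal.ofReal (c * entropyConst p m α * √s * δ⁻¹) *
            (⨆ (k : ℕ) (_ : 1 ≤ k),
              (∫⁻ ω, ⨆ j, (α (v j ω) : ℝ≥0∞) ^ (2 * k) ∂μ) ^ (1 / (2 * k : ℝ))) ≤
          ENNReal.ofReal ((m : ℝ) ^ (1 / p) / (1 + Real.log m) ^ (logExponent p / 2)) →
        ENNReal.ofReal (c * (δ ^ 2)⁻¹ * s * Real.log ζ⁻¹) *
            (⨆ (k : ℕ) (_ : 1 ≤ k),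
              (∫⁻ ω, ⨆ j, ‖v j ω‖ₑ ^ (2 * k) ∂μ) ^ (1 / (k : ℝ))) ≤
          ENNReal.ofReal (m : ℝ) →
        μ {ω | ¬ SatisfiesRIP K s δ Φ (measurementOp fun j => v j ω)} ≤ ENNReal.ofReal ζ := by
  -- The second condition on `m` enters through a square root, so `c = 3600²` leaves the `3600`
  -- needed in the pointwise term.
  refine ⟨3600 ^ 2, by norm_num, ?_⟩
  intro 𝕜 _ H _ _ _ _ _ Ω _ μ _ K d m p s δ ζ α Φ v hm _ _ hs hδ hζ hζ1 _ htype hv hα hind hsm hΦ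
    h1 h2
  have hm0 : (0 : ℝ) < m := by exact_mod_cast hm
  let φ : K.Space → ℝ := fun x => RCLike.re (inner 𝕜 (K.incl x) (Φ (K.incl x)))
  have hφ : ∀ j x, ∫ ω, ‖v j ω x‖ ^ 2 ∂μ = φ x := fun j x => by
    simp only [φ, (hsm j).inner_eq_integral x, RCLike.ofReal_re]
  have hinner : ∀ x, inner 𝕜 (K.incl x) (Φ (K.incl x)) = (φ x : 𝕜) := fun x => by
    rw [(hsm ⟨0, hm⟩).inner_eq_integral x, hφ]
  have hS : ∀ x ∈ K.unitSparse s, ‖x‖ ≤ √s := fun x hx => by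
    have := hx.1
    rw [SymmConvexBody.sparse, Set.mem_ofPred_eq, hx.2, mul_one] at this
    exact this
  have hφ1 : ∀ x ∈ K.unitSparse s, φ x ≤ 1 := fun x hx => by
    calc φ x ≤ ‖K.incl x‖ * ‖Φ (K.incl x)‖ := re_inner_le_norm _ _
      _ ≤ ‖K.incl x‖ * (‖Φ‖ * ‖K.incl x‖) := by gcongr; exact Φ.le_opNorm _
      _ ≤ 1 := by rw [hx.2]; linarith
  have hφc : Continuous φ := RCLike.continuous_re.comp
    (K.incl.continuous.inner (Φ.continuous.comp K.incl.continuous))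
  have key := measure_exists_lt_le_of_entropySum_le hm hv hind (S := K.unitSparse s) hφc
    (fun j x _ => (hsm j).integrable_norm_sq x) (fun j x _ => hφ j x) hφ1 hs hS hδ hζ hζ1
    (ae_entropySum_le hm hs hδ (by norm_num) htype hα h1)
    (fun x hx j => ae_norm_apply_sq_le hs hδ (Real.log_pos ((one_lt_inv₀ hζ).2 hζ1)) (by norm_num)
      (fun j => (hv j).1) (hS x hx) h2 j)
  refine (measure_mono fun ω hω => ?_).trans key
  simp only [Set.mem_ofPred_eq, SatisfiesRIP, not_forall, not_le] at hω ⊢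
  obtain ⟨x, hx, hlt⟩ := hω
  refine ⟨x, hx, ?_⟩
  rw [hinner, ← RCLike.ofReal_sub, RCLike.norm_ofReal, norm_measurementOp_sq] at hlt
  calc max δ (δ ^ 2) * m < |(∑ j, ‖v j ω x‖ ^ 2) / m - φ x| * m := by gcongr
    _ = |∑ j, ‖v j ω x‖ ^ 2 - m * φ x| := by
      rw [← abs_of_pos hm0, ← abs_mul, abs_of_pos hm0, sub_mul, div_mul_cancel₀ _ hm0.ne',
        mul_comm (φ x)]
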